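/- Let $E$ be a (real) Banach lattice, with norm dual $E'$ and norm bidual $E''$ (ordered as dual and bidual), and regard $E$ as a subspace of $E''$ through the canonical embedding. For $v\in (E'')^+$ let $[-v,v]=\{w\in E'' : -v\le w\le v\}$. Conventions. For $A\subset E$, $\mathrm{sol}(A)=\{x\in E : |x|\le |y| \text{ for some } y\in A\}$. A net $(x_\alpha)$ in $E$ is uaw-convergent to $x$, written $x_\alpha\overset{uaw}{\longrightarrow}x$, if $|x_\alpha-x|\wedge u\to 0$ weakly for every $u\in E^+$. A norm bounded set $A\subset E$ is uaw-compact (resp. relatively uaw-compact) if every net in $A$ has a subnet that is uaw-convergent to a point of $A$ (resp. of $E$). A norm bounded set $A\subset E$ is L-weakly compact if $\|x_n\|\to 0$ for every disjoint sequence $(x_n)$ in $\mathrm{sol}(A)$. For a norm bounded set $\mathcal S\subset E$, a bounded operator $T:E\to Y$ into a Banach space is $\mathcal S$-L-weakly compact if $\|T(x_n)\|\to 0$ for every uaw-null sequence $(x_n)$ in $\mathrm{sol}(\mathcal S)$. A set $A\subset E$ is b-order bounded if $A\subset[-v,v]$ for some $v\in(E'')^+$, and b-semi compact if for every $\varepsilon>0$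 there is $v\in (E'')^+$ with $A\subset [-v,v]+\varepsilon B_{E''}$, where $B_{E''}$ is the closed unit ball of $E''$. $E$ is a KB-space if every norm bounded increasing sequence in $E^+$ is norm convergent. The following statements are equivalent: 1. $E$ is a KB-space. 2. Every b-semi compact subset of $E$ is L-weakly compact. 3. For every $v\in (E'')^+$, $\mathrm{Id}_E$ is $([-v,v]\cap E)$-L-weakly compact. 4. For every $\varepsilon>0$ and every $v\in (E'')^+$ there exist $g\in (E')^+$ and $u\in E^+$ such that $\|x\|\le g(|x|\wedge u)+\varepsilon$ for all $x\in[-v,v]\cap E$. 5. For every $v\in (E'')^+$ and every net $(x_\alpha)$ in $[-v,v]\cap E$ with $x_\alpha\overset{uaw}{\longrightarrow}0$, we have $\|x_\alpha\|\to 0$. 6. For every $v\in (E'')^+$ and every sequence $(x_n)$ in $[-v,v]\cap E$ with $x_n\overset{uaw}{\longrightarrow}0$, we have $\|x_n\|\to 0$. 7. Every b-order bounded uaw-compact subset of $E$ is norm compact. 8. Every b-order bounded relatively uaw-compact subset of $E$ is relatively norm compact. -/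

import Mathlib

open Filter Topology LatticeOrderedAddCommGroup

universe u v w

namespace BanachLattice

section

variable {E : Type u} [NormedAddCommGroup E] [NormedSpace ℝ E] [Lattice E]

/-- The positive cone `(E')⁺` of the norm dual. -/
def DualNonneg (f : StrongDual ℝ E) : Prop :=
  ∀ x : E, 0 ≤ x → 0 ≤ f x

/-- The order of the norm bidual `E''`: `φ ≤ ψ` when `φ f ≤ ψ f` for all `f ∈ (E')⁺`. -/
def BidualLE (φ ψ : StrongDual ℝ (StrongDual ℝ E)) : Prop :=
  ∀ f : StrongDual ℝ E, DualNonneg f → φ f ≤ ψ f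

/-- The positive cone `(E'')⁺` of the norm bidual. -/
def BidualNonneg (φ : StrongDual ℝ (StrongDual ℝ E)) : Prop :=
  BidualLE 0 φ

/-- The order interval `[-φ, φ]` of the norm bidual. -/
def bidualInterval (φ : StrongDual ℝ (StrongDual ℝ E)) : Set (StrongDual ℝ (StrongDual ℝ E)) :=
  {ψ | BidualLE (-φ) ψ ∧ BidualLE ψ φ}

/-- The set `[-φ, φ] ∩ E`, where `E` is canonically embedded in `E''`. -/
def bInterval (φ : StrongDual ℝ (StrongDual ℝ E)) : Set E :=
  {x | NormedSpace.inclusionInDoubleDual ℝ E x ∈ bidualInterval φ}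

/-- A subset of `E` is b-order bounded when it is order bounded in `E''`. -/
def IsBOrderBounded (A : Set E) : Prop :=
  ∃ φ : StrongDual ℝ (StrongDual ℝ E), BidualNonneg φ ∧ A ⊆ bInterval φ

/-- A subset of `E` is b-semi compact when it is almost order bounded in `E''`: for every `ε > 0`
there is `φ ∈ (E'')⁺` with `A ⊆ [-φ, φ] + ε B_{E''}`. -/
def IsBSemiCompact (A : Set E) : Prop :=
  ∀ ε : ℝ, 0 < ε → ∃ φ : StrongDual ℝ (StrongDual ℝ E), BidualNonneg φ ∧
    ∀ x ∈ A, ∃ ψ ∈ bidualInterval φ, ‖NormedSpace.inclusionInDoubleDual ℝ E x - ψ‖ ≤ ε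

/-- Unbounded absolutely weak (uaw) convergence of a family along a filter: for each `y ≥ 0`,
`|x i - a| ⊓ y` tends weakly to `0`. For a net, the filter is `atTop`. -/
def UawTendsto {ι : Type w} (x : ι → E) (l : Filter ι) (a : E) : Prop :=
  ∀ y : E, 0 ≤ y → ∀ f : StrongDual ℝ E, Tendsto (fun i => f (|x i - a| ⊓ y)) l (𝓝 0)

/-- Some subnet of the net `x` is uaw-convergent to `a`. -/
def HasUawSubnetTendsto {ι : Type u} [Preorder ι] (x : ι → E) (a : E) : Prop :=
  ∃ (κ : Type u) (_ : Preorder κ) (_ : IsDirectedOrder κ) (_ : Nonempty κ) (φ : κ → ι),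
    Tendsto φ atTop atTop ∧ UawTendsto (x ∘ φ) atTop a

/-- A norm bounded set `A` is uaw-compact when every net in `A` has a subnet that is
uaw-convergent to a point of `A`. -/
def IsUawCompact (A : Set E) : Prop :=
  Bornology.IsBounded A ∧
    ∀ (ι : Type u) [Preorder ι] [IsDirectedOrder ι] [Nonempty ι] (x : ι → E),
      (∀ i, x i ∈ A) → ∃ a ∈ A, HasUawSubnetTendsto x a

/-- A norm bounded set `A` is relatively uaw-compact when every net in `A` has a subnet that is
uaw-convergent to a point of `E`. -/
def IsRelUawCompact (A : Set E) : Prop :=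
  Bornology.IsBounded A ∧
    ∀ (ι : Type u) [Preorder ι] [IsDirectedOrder ι] [Nonempty ι] (x : ι → E),
      (∀ i, x i ∈ A) → ∃ a : E, HasUawSubnetTendsto x a

/-- `T` is `S`-L-weakly compact: `S` is norm bounded and `T` maps each uaw-null sequence of the
solid hull of `S` to a norm null sequence. -/
def IsLwcOn {Y : Type v} [NormedAddCommGroup Y] [NormedSpace ℝ Y] (S : Set E) (T : E →L[ℝ] Y) :
    Prop :=
  Bornology.IsBounded S ∧
    ∀ x : ℕ → E, (∀ n, x n ∈ solidClosure S) → UawTendsto x atTop 0 →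
      Tendsto (fun n => T (x n)) atTop (𝓝 0)

end

section

variable {E : Type u} [NormedAddCommGroup E] [Lattice E]

/-- A norm bounded set `A` is L-weakly compact when each disjoint sequence of its solid hull is
norm null. -/
def IsLWeaklyCompact (A : Set E) : Prop :=
  Bornology.IsBounded A ∧
    ∀ x : ℕ → E, (∀ n, x n ∈ solidClosure A) → (Pairwise fun m n => |x m| ⊓ |x n| = 0) →
      Tendsto x atTop (𝓝 0)

/-- `E` is a KB-space: each norm bounded increasing sequence of `E⁺` is norm convergent. -/
def IsKBSpace (E : Type u) [NormedAddCommGroup E] [Lattice E] : Prop :=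
  ∀ x : ℕ → E, Monotone x → (∀ n, 0 ≤ x n) → (∃ C : ℝ, ∀ n, ‖x n‖ ≤ C) →
    ∃ a : E, Tendsto x atTop (𝓝 a)

end

end BanachLattice

/-! Everything rests on comparing `E` with an element `φ ≥ 0` of the bidual. In a KB-space, an
exhaustion argument puts `[-φ, φ] ∩ E` inside an order interval `[-w, w]` of `E`
(`IsKBSpace.exists_upper_bound`), and on `[0, w]` the norm is bounded by a single positive
functional up to `ε` (`MonotoneConvergesBelow.exists_norm_le`). This is statement 4 with `u = w`. It
makes uaw convergence of b-order bounded nets the same as norm convergence, which gives 5, 6, 3, 7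
and 8.

Conversely, a norm bounded increasing sequence lies below a weak* cluster point in `E''`. Its
increments along any subsequence have norm bounded partial sums, hence are uaw-null and b-order
bounded, so 6 makes the sequence Cauchy. Both 7 and 8 give 6, because the range of a uaw-null
b-order bounded sequence together with `0` is uaw-compact, and inside a norm compact set such a
sequence can only cluster at `0`.

The hard part of 1 → 2 is that points of a b-semi compact set decompose only in `E''`.
`MonotoneConvergesBelow.exists_truncation` replaces the decomposition by one in `E`: Hahn–Banach
separation meets finitely many of the constraints, and minimising a uniformly convex functional
meets all of them approximately. The truncations of a disjoint sequence are disjoint with norm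
bounded partial sums, so they are norm null in a KB-space.

For 2 → 1, the increments `d n` of an increasing sequence satisfy `d n ⊓ d m → 0` as `m → ∞`.
Increments that are not norm null would then have a subsequence close to a disjoint sequence,
against 2 (`tendsto_zero_of_disjoint`). -/

namespace BanachLattice

set_option linter.unusedSectionVars false

/-! ### Inequalities in lattice ordered groups -/

section LatticeGroup

variable {E : Type u} [AddCommGroup E] [Lattice E] [IsOrderedAddMonoid E]

theorem inf_add_le_inf_add_inf {a b c : E} (ha : 0 ≤ a) (hb : 0 ≤ b) (hc : 0 ≤ c) :
    a ⊓ (b + c) ≤ a ⊓ b + a ⊓ c := by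
  rw [add_inf, inf_add, inf_add]
  refine le_inf (le_inf ?_ ?_) (le_inf ?_ inf_le_right)
  · exact inf_le_left.trans (le_add_of_nonneg_right ha)
  · exact inf_le_left.trans (le_add_of_nonneg_left hb)
  · exact inf_le_left.trans (le_add_of_nonneg_right hc)

theorem posPart_inf_posPart (a b : E) : a⁺ ⊓ b⁺ = (a ⊓ b)⁺ := by
  let := AddCommGroup.toDistribLattice E
  exact (sup_inf_right a b 0).symm

theorem posPart_inf_posPart_neg (a : E) : a⁺ ⊓ (-a)⁺ = 0 := by
  rw [posPart_neg]; exact posPart_inf_negPart_eq_zero a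

theorem posPart_add_le (a b : E) : (a + b)⁺ ≤ a⁺ + b⁺ :=
  sup_le (add_le_add (le_posPart a) (le_posPart b))
    (add_nonneg (posPart_nonneg a) (posPart_nonneg b))

/-- The defect of subadditivity of the positive part controls the overlap of opposite parts. -/
theorem posPart_inf_posPart_neg_le (a b : E) :
    a⁺ ⊓ (-b)⁺ ≤ a⁺ + b⁺ - (a + b)⁺ := by
  have h : a⁺ - a⁺ ⊓ (-b)⁺ = (a⁺ - (-b)⁺)⁺ := by
    have := inf_add_sup (a⁺) ((-b)⁺)
    have h2 := sup_eq_add_posPart_sub (a⁺) ((-b)⁺)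
    rw [h2] at this
    rw [sub_eq_iff_eq_add]
    have h3 : a⁺ ⊓ (-b)⁺ + (a⁺ - (-b)⁺)⁺ + (-b)⁺ = a⁺ + (-b)⁺ := by
      rw [← this]; abel
    rw [add_comm, add_right_cancel h3]
  have h4 : (a + b)⁺ ≤ b⁺ + (a⁺ - (-b)⁺)⁺ := by
    refine sup_le ?_ (add_nonneg (posPart_nonneg _) (posPart_nonneg _))
    calc a + b ≤ a⁺ + (b⁺ - b⁻) := by
          rw [posPart_sub_negPart]; exact add_le_add_left (le_posPart a) b
      _ = b⁺ + (a⁺ - (-b)⁺) := by rw [posPart_neg]; abel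
      _ ≤ _ := add_le_add_right (le_posPart _) _
  rw [← h] at h4
  rw [le_sub_iff_add_le]
  calc a⁺ ⊓ (-b)⁺ + (a + b)⁺ ≤ a⁺ ⊓ (-b)⁺ + (b⁺ + (a⁺ - a⁺ ⊓ (-b)⁺)) := add_le_add_right h4 _
    _ = a⁺ + b⁺ := by abel

/-- If no level of the scale `t` separates `z` from `y` by more than `s`, then `y - z` is at most
the mesh of the scale plus `2 s`. -/
theorem sub_le_of_levels {y z d s : E} {t : ℕ → E} {N : ℕ} (h0 : t 0 ≤ z) (hN : y ≤ t N)
    (hd : ∀ k < N, t (k + 1) ≤ t k + d) (hd0 : 0 ≤ d)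
    (hs0 : 0 ≤ s) (hs : ∀ k ≤ N, (y - t k)⁺ ⊓ (t k - z)⁺ ≤ s) : y - z ≤ d + s + s := by
  have key : ∀ k ≤ N, (y - t k - s)⁺ ⊓ (t k - z - s)⁺ = 0 := by
    intro k hk
    rw [posPart_inf_posPart, ← inf_sub, posPart_eq_zero, sub_nonpos]
    refine le_trans ?_ (hs k hk)
    exact inf_le_inf (le_posPart _) (le_posPart _)
  -- The excess `w` turns out disjoint from `(t k - z - s)⁺` for every `k`: this is trivial at `k =
  -- 0`, and `key` carries it from one level to the next. At `k = N` the excess lies below that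
  -- part, so it vanishes.
  set w := (y - z - (d + s + s))⁺ with hw
  have w0 : 0 ≤ w := posPart_nonneg _
  have ind : ∀ k ≤ N, w ⊓ (t k - z - s)⁺ = 0 := by
    intro k
    induction k with
    | zero =>
      intro _
      have : (t 0 - z - s)⁺ = 0 := by
        rw [posPart_eq_zero]
        exact (sub_le_self _ hs0).trans (sub_nonpos.2 h0)
      rw [this]; exact inf_eq_right.2 w0
    | succ k ih =>
      intro hk
      have h1 := ih (by omega)
      have h2 : w ≤ (y - t (k + 1) - s)⁺ + (t k - z - s)⁺ := by
        refine sup_le ?_ (add_nonneg (posPart_nonneg _) (posPart_nonneg _))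
        calc y - z - (d + s + s) = (y - (t k + d) - s) + (t k - z - s) := by abel
          _ ≤ (y - t (k + 1) - s) + (t k - z - s) := by
              gcongr; exact hd k (by omega)
          _ ≤ _ := add_le_add (le_posPart _) (le_posPart _)
      have h3 : w ≤ (y - t (k + 1) - s)⁺ := by
        calc w = w ⊓ ((y - t (k + 1) - s)⁺ + (t k - z - s)⁺) := (inf_eq_left.2 h2).symm
          _ ≤ _ := inf_add_le_inf_add_inf w0 (posPart_nonneg _) (posPart_nonneg _)
          _ = w ⊓ (y - t (k + 1) - s)⁺ := by rw [h1, add_zero]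
          _ ≤ _ := inf_le_right
      refine le_antisymm ?_ (le_inf w0 (posPart_nonneg _))
      rw [← key (k + 1) hk]
      exact inf_le_inf_right _ h3
  have hwN : w = 0 := by
    refine le_antisymm ?_ w0
    rw [← ind N le_rfl]
    refine le_inf le_rfl (posPart_mono ?_)
    have h1 := add_nonneg (add_nonneg (sub_nonneg.2 hN) hd0) hs0
    rw [← sub_nonneg]
    convert h1 using 1
    abel
  rw [hw, posPart_eq_zero, sub_nonpos] at hwN
  exact hwN

end LatticeGroup

/-! ### Hahn–Banach for sublinear functionals -/

section Functionals

variable {E : Type u} [NormedAddCommGroup E] [NormedSpace ℝ E]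

/-- Hahn–Banach: a sublinear functional has a linear minorant that agrees with it at a point. -/
theorem exists_linear_le_sublinear (p : E → ℝ) (hp : ∀ c : ℝ, 0 < c → ∀ x, p (c • x) = c * p x)
    (ha : ∀ x y, p (x + y) ≤ p x + p y) (x₀ : E) :
    ∃ g : E →ₗ[ℝ] ℝ, g x₀ = p x₀ ∧ ∀ x, g x ≤ p x := by
  have p0 : p 0 = 0 := by
    have := hp 2 two_pos 0
    rw [smul_zero] at this; linarith
  by_cases hx : x₀ = 0
  · obtain ⟨g, -, h2⟩ := exists_extension_of_le_sublinear (⊥ : E →ₗ.[ℝ] ℝ) p hp ha (by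
      rintro ⟨x, hx⟩
      have hx' : x = 0 := (Submodule.mem_bot ℝ).1 hx
      subst hx'
      have : (⟨0, hx⟩ : (⊥ : E →ₗ.[ℝ] ℝ).domain) = 0 := rfl
      rw [this, LinearPMap.map_zero]
      exact p0.ge)
    exact ⟨g, by rw [hx, map_zero, p0], h2⟩
  · obtain ⟨g, h1, h2⟩ := exists_extension_of_le_sublinear
      (LinearPMap.mkSpanSingleton (K := ℝ) x₀ (p x₀) hx) p hp ha (by
      rintro ⟨x, hxs⟩
      obtain ⟨t, rfl⟩ := Submodule.mem_span_singleton.1 hxs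
      refine le_of_eq_of_le (LinearPMap.mkSpanSingleton'_apply x₀ (p x₀) _ t hxs) ?_
      simp only [smul_eq_mul, RingHom.id_apply]
      rcases lt_trichotomy t 0 with ht | ht | ht
      · have h1 := hp (-t) (neg_pos.2 ht) x₀
        have h2 := ha (t • x₀) ((-t) • x₀)
        rw [← add_smul, add_neg_cancel, zero_smul, p0, h1] at h2
        linarith
      · subst ht; simp [p0]
      · exact (hp t ht x₀).ge)
    refine ⟨g, ?_, h2⟩
    have := h1 ⟨x₀, Submodule.mem_span_singleton_self x₀⟩
    rw [this]
    exact LinearPMap.mkSpanSingleton'_apply_self x₀ (p x₀) _ _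

end Functionals

section Module

variable {E : Type u} [AddCommGroup E] [Module ℝ E] [Lattice E] [IsOrderedAddMonoid E]
  [IsOrderedModule ℝ E]

theorem posPart_smul {c : ℝ} (hc : 0 < c) (x : E) : (c • x)⁺ = c • x⁺ := by
  have h := OrderIso.map_sup (OrderIso.smulRight hc : E ≃o E) x 0
  exact (h.trans (congrArg _ (smul_zero c))).symm

end Module

/-! ### Positive functionals and domination by the bidual -/

section Dual

variable {E : Type u} [NormedAddCommGroup E] [NormedSpace ℝ E] [Lattice E]
  [IsOrderedAddMonoid E]

theorem DualNonneg.mono {f : StrongDual ℝ E} (hf : DualNonneg f) {x y : E} (h : x ≤ y) :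
    f x ≤ f y := by
  have := hf (y - x) (sub_nonneg.2 h)
  rw [map_sub] at this; linarith

theorem DualNonneg.add {f g : StrongDual ℝ E} (hf : DualNonneg f) (hg : DualNonneg g) :
    DualNonneg (f + g) := fun x hx => add_nonneg (hf x hx) (hg x hx)

theorem DualNonneg.smul {f : StrongDual ℝ E} (hf : DualNonneg f) {c : ℝ} (hc : 0 ≤ c) :
    DualNonneg (c • f) := fun x hx => mul_nonneg hc (hf x hx)

theorem DualNonneg.zero : DualNonneg (0 : StrongDual ℝ E) := fun _ _ => le_rfl

theorem DualNonneg.abs_apply_le {f : StrongDual ℝ E} (hf : DualNonneg f) (x : E) :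
    |f x| ≤ f |x| := by
  rw [abs_le']
  refine ⟨hf.mono (le_abs_self x), ?_⟩
  rw [← map_neg]; exact hf.mono (neg_le_abs x)

variable [HasSolidNorm E]

theorem norm_le_norm_of_nonneg {x y : E} (hx : 0 ≤ x) (h : x ≤ y) : ‖x‖ ≤ ‖y‖ :=
  norm_le_norm_of_abs_le_abs (by rwa [abs_of_nonneg hx, abs_of_nonneg (hx.trans h)])

theorem norm_posPart_le (x : E) : ‖x⁺‖ ≤ ‖x‖ := by
  rw [← norm_abs_eq_norm x]
  exact norm_le_norm_of_nonneg (posPart_nonneg x) (sup_le (le_abs_self x) (abs_nonneg x))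

theorem norm_le_of_dualNonneg_sub {f g : StrongDual ℝ E} (hg : DualNonneg g)
    (hfg : DualNonneg (f - g)) : ‖g‖ ≤ ‖f‖ := by
  refine ContinuousLinearMap.opNorm_le_bound _ (norm_nonneg _) fun x => ?_
  have h1 : f |x| - g |x| ≥ 0 := hfg _ (abs_nonneg x)
  have h2 := hg.abs_apply_le x
  have h3 : f |x| ≤ ‖f‖ * ‖x‖ := by
    rw [← norm_abs_eq_norm x]; exact (le_abs_self _).trans (f.le_opNorm _)
  rw [Real.norm_eq_abs]; linarith

variable [IsOrderedModule ℝ E]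

/-- A functional dominated by a positively homogeneous function of `y⁺` is positive. -/
theorem exists_dualNonneg_le_sublinear (p : E → ℝ) (hp : ∀ c : ℝ, 0 < c → ∀ x, p (c • x) = c * p x)
    (ha : ∀ x y, p (x + y) ≤ p x + p y) {C : ℝ} (hC : ∀ x, p x ≤ C * ‖x⁺‖) (hC0 : 0 ≤ C) (x₀ : E) :
    ∃ g : StrongDual ℝ E, DualNonneg g ∧ ‖g‖ ≤ C ∧ g x₀ = p x₀ ∧ ∀ x, g x ≤ p x := by
  obtain ⟨g, h1, h2⟩ := exists_linear_le_sublinear p hp ha x₀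
  have hb : ∀ x, ‖g x‖ ≤ C * ‖x‖ := by
    intro x
    rw [Real.norm_eq_abs, abs_le']
    constructor
    · exact ((h2 x).trans (hC x)).trans (by gcongr; exact norm_posPart_le x)
    · rw [← map_neg, ← norm_neg x]
      exact ((h2 (-x)).trans (hC (-x))).trans (by gcongr; exact norm_posPart_le (-x))
  refine ⟨g.mkContinuous C hb, ?_, g.mkContinuous_norm_le hC0 hb, h1, h2⟩
  intro x hx
  have h3 := (h2 (-x)).trans (hC (-x))
  rw [posPart_eq_zero.2 (neg_nonpos.2 hx), norm_zero, mul_zero, map_neg] at h3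
  change 0 ≤ g x
  linarith

/-- Apply Hahn–Banach to `y ↦ ‖y⁺‖`, which vanishes on the negative cone and so forces positivity.
-/
theorem exists_dualNonneg_norming {x : E} (hx : 0 ≤ x) :
    ∃ g : StrongDual ℝ E, DualNonneg g ∧ ‖g‖ ≤ 1 ∧ g x = ‖x‖ := by
  obtain ⟨g, h1, h2, h3, -⟩ := exists_dualNonneg_le_sublinear (fun y : E => ‖y⁺‖)
    (fun c hc y => by rw [posPart_smul hc, norm_smul, Real.norm_of_nonneg hc.le])
    (fun y z => (norm_le_norm_of_nonneg (posPart_nonneg _) (posPart_add_le y z)).trans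
      (norm_add_le _ _)) (C := 1) (fun y => by rw [one_mul]) zero_le_one x
  exact ⟨g, h1, h2, by rw [h3, posPart_of_nonneg hx]⟩

/-- A linear minorant of `y ↦ f y⁺` lies between `0` and `f`. It attains the Riesz–Kantorovich
supremum at `x`, so no lattice structure on the dual is needed. -/
theorem DualNonneg.exists_split {f : StrongDual ℝ E} (hf : DualNonneg f) (x : E) :
    ∃ g : StrongDual ℝ E, DualNonneg g ∧ DualNonneg (f - g) ∧ g x = f x⁺ := by
  obtain ⟨g, h1, -, h3, h4⟩ := exists_dualNonneg_le_sublinear (fun y : E => f y⁺)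
    (fun c hc y => by rw [posPart_smul hc, map_smul, smul_eq_mul])
    (fun y z => by rw [← map_add]; exact hf.mono (posPart_add_le y z)) (C := ‖f‖)
    (fun y => (le_abs_self _).trans (f.le_opNorm _)) (norm_nonneg f) x
  refine ⟨g, h1, fun y hy => ?_, h3⟩
  have := h4 y
  rw [posPart_of_nonneg hy] at this
  exact sub_nonneg.2 this

theorem norm_le_of_dualNonneg {x : E} (hx : 0 ≤ x) {C : ℝ}
    (h : ∀ f : StrongDual ℝ E, DualNonneg f → ‖f‖ ≤ 1 → f x ≤ C) : ‖x‖ ≤ C := by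
  obtain ⟨g, h1, h2, h3⟩ := exists_dualNonneg_norming hx
  rw [← h3]; exact h g h1 h2

/-- `x ≤ φ + c B` in the bidual order, tested on positive functionals. -/
def DominatedBy (φ : StrongDual ℝ (StrongDual ℝ E)) (c : ℝ) (x : E) : Prop :=
  ∀ f : StrongDual ℝ E, DualNonneg f → f x ≤ φ f + c * ‖f‖

variable {φ : StrongDual ℝ (StrongDual ℝ E)}

theorem DominatedBy.of_le {c : ℝ} {x y : E} (hy : DominatedBy φ c y) (h : x ≤ y) :
    DominatedBy φ c x := fun f hf => (hf.mono h).trans (hy f hf)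

theorem BidualNonneg.dominatedBy_zero (hφ : BidualNonneg φ) : DominatedBy φ 0 (0 : E) := by
  intro f hf
  rw [map_zero, zero_mul, add_zero]; exact hφ f hf

/-- Splitting `f` along `x - y` gives `f (x ⊔ y) = g x + (f - g) y`. The two bounds add up, since `φ
g + φ (f - g) = φ f` and both pieces have norm at most `‖f‖`. -/
theorem DominatedBy.sup {c d : ℝ} (hc : 0 ≤ c) (hd : 0 ≤ d) {x y : E} (hx : DominatedBy φ c x)
    (hy : DominatedBy φ d y) : DominatedBy φ (c + d) (x ⊔ y) := by
  intro f hf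
  obtain ⟨g, h1, h2, h3⟩ := hf.exists_split (x - y)
  have n1 := norm_le_of_dualNonneg_sub h1 h2
  have n2 : ‖f - g‖ ≤ ‖f‖ := norm_le_of_dualNonneg_sub h2 (by rwa [sub_sub_cancel])
  have e1 := hx g h1
  have e2 := hy (f - g) h2
  rw [sup_eq_add_posPart_sub, map_add, ← h3, map_sub]
  rw [map_sub, _root_.sub_apply] at e2
  have m1 := mul_le_mul_of_nonneg_left n1 hc
  have m2 := mul_le_mul_of_nonneg_left n2 hd
  linarith

theorem DominatedBy.sup_zero {x y : E} (hx : DominatedBy φ 0 x) (hy : DominatedBy φ 0 y) :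
    DominatedBy φ 0 (x ⊔ y) := by
  simpa using hx.sup le_rfl le_rfl hy

theorem DominatedBy.norm_le {c : ℝ} (hc : 0 ≤ c) {x : E} (hx : DominatedBy φ c x) (h0 : 0 ≤ x) :
    ‖x‖ ≤ ‖φ‖ + c := by
  refine norm_le_of_dualNonneg h0 fun f hf hf1 => (hx f hf).trans ?_
  have h1 : φ f ≤ ‖φ‖ * ‖f‖ := (le_abs_self _).trans (φ.le_opNorm f)
  have h2 := mul_le_mul_of_nonneg_left hf1 (norm_nonneg φ)
  have h3 := mul_le_mul_of_nonneg_left hf1 hc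
  linarith

theorem mem_bInterval_iff {x : E} : x ∈ bInterval φ ↔ DominatedBy φ 0 |x| := by
  constructor
  · rintro ⟨h1, h2⟩
    refine DominatedBy.sup_zero (fun f hf => ?_) (fun f hf => ?_)
    · have := h2 f hf
      rw [NormedSpace.dual_def] at this; linarith
    · have := h1 f hf
      rw [NormedSpace.dual_def, _root_.neg_apply] at this
      rw [map_neg]; linarith
  · intro h
    refine ⟨fun f hf => ?_, fun f hf => ?_⟩
    · have := (h.of_le (neg_le_abs x)) f hf
      rw [map_neg] at this
      rw [NormedSpace.dual_def, _root_.neg_apply]; linarith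
    · have := (h.of_le (le_abs_self x)) f hf
      rw [NormedSpace.dual_def]; linarith

theorem mem_bInterval_of_abs_le {x y : E} (hy : y ∈ bInterval φ) (h : |x| ≤ |y|) :
    x ∈ bInterval φ :=
  mem_bInterval_iff.2 ((mem_bInterval_iff.1 hy).of_le h)

theorem mem_bInterval_of_mem_solidClosure {x : E} (hx : x ∈ solidClosure (bInterval φ)) :
    x ∈ bInterval φ := by
  obtain ⟨y, hy, h⟩ := hx
  exact mem_bInterval_of_abs_le hy h

theorem norm_le_of_mem_bInterval {x : E} (hx : x ∈ bInterval φ) : ‖x‖ ≤ ‖φ‖ := by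
  rw [← norm_abs_eq_norm]
  simpa using (mem_bInterval_iff.1 hx).norm_le le_rfl (abs_nonneg x)

theorem isBounded_bInterval : Bornology.IsBounded (bInterval φ : Set E) :=
  isBounded_iff_forall_norm_le.2 ⟨‖φ‖, fun _ => norm_le_of_mem_bInterval⟩

theorem bidualNonneg_inclusion {x : E} (hx : 0 ≤ x) :
    BidualNonneg (NormedSpace.inclusionInDoubleDual ℝ E x) := by
  intro f hf
  rw [NormedSpace.dual_def]; exact hf x hx

/-- A norm bounded increasing sequence is dominated by an element of the bidual. -/
theorem exists_bidual_dominating {x : ℕ → E} (hx : Monotone x) (h0 : ∀ n, 0 ≤ x n) {C : ℝ}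
    (hC : ∀ n, ‖x n‖ ≤ C) :
    ∃ φ : StrongDual ℝ (StrongDual ℝ E), BidualNonneg φ ∧ ∀ n, DominatedBy φ 0 (x n) := by
  -- By Banach–Alaoglu the embedded sequence converges weak* along a free ultrafilter. Monotonicity
  -- puts the limit above every term on positive functionals.
  let J : ℕ → WeakDual ℝ (StrongDual ℝ E) :=
    fun n => StrongDual.toWeakDual (NormedSpace.inclusionInDoubleDual ℝ E (x n))
  obtain ⟨φ, -, hφ⟩ := (WeakDual.isCompact_closedBall (𝕜 := ℝ) (E := StrongDual ℝ E) 0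
    C).ultrafilter_le_nhds ((hyperfilter ℕ).map J) (by
      rw [le_principal_iff]
      refine Ultrafilter.mem_map.2 (Filter.univ_mem' fun n => ?_)
      have h1 := (NormedSpace.double_dual_bound ℝ E (x n)).trans (hC n)
      exact (mem_closedBall_zero_iff (E := StrongDual ℝ (StrongDual ℝ E))).2 h1)
  have hJ : Tendsto J (hyperfilter ℕ) (𝓝 φ) := hφ
  have key : ∀ f : StrongDual ℝ E, DualNonneg f → ∀ n, f (x n) ≤ φ f := by
    intro f hf n
    have h1 : Tendsto (fun m => f (x m)) (hyperfilter ℕ) (𝓝 (φ f)) :=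
      ((WeakDual.eval_continuous f).tendsto φ).comp hJ
    refine ge_of_tendsto h1 ?_
    have : ∀ᶠ m in atTop, f (x n) ≤ f (x m) :=
      (eventually_ge_atTop n).mono fun m hm => hf.mono (hx hm)
    exact (Nat.hyperfilter_le_atTop) this
  refine ⟨WeakDual.toStrongDual φ, fun f hf => ?_, fun n f hf => ?_⟩
  · exact (hf _ (h0 0)).trans (key f hf 0)
  · rw [zero_mul, add_zero]; exact key f hf n

end Dual

/-! ### Order intervals on which increasing sequences converge -/

section OrderContinuity

variable {E : Type u} [NormedAddCommGroup E] [Lattice E]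

/-- Every increasing sequence of the order interval `[0, w]` is norm convergent. -/
def MonotoneConvergesBelow (w : E) : Prop :=
  ∀ x : ℕ → E, Monotone x → (∀ n, 0 ≤ x n) → (∀ n, x n ≤ w) → ∃ a, Tendsto x atTop (𝓝 a)

/-- Otherwise, iterating a choice of a later index at distance at least `ε` produces a subsequence
whose consecutive differences stay large. -/
theorem cauchySeq_of_subseq_diff {x : ℕ → E}
    (h : ∀ σ : ℕ → ℕ, StrictMono σ → Tendsto (fun k => x (σ (k + 1)) - x (σ k)) atTop (𝓝 0)) :
    CauchySeq x := by
  rw [Metric.cauchySeq_iff']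
  by_contra! hc
  obtain ⟨ε, hε, hc⟩ := hc
  choose s hs1 hs2 using hc
  have hs3 : ∀ N, N < s N := fun N => lt_of_le_of_ne (hs1 N) fun hN => by
    have := hs2 N
    rw [← hN, dist_self] at this
    linarith
  have hσ : StrictMono (fun k => s^[k] 0) := strictMono_nat_of_lt_succ fun k => by
    rw [Function.iterate_succ_apply']; exact hs3 _
  have h1 := (h _ hσ).norm.eventually (gt_mem_nhds (by rwa [norm_zero] : ‖(0 : E)‖ < ε))
  obtain ⟨k, hk⟩ := h1.exists
  have h2 := hs2 (s^[k] 0)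
  rw [dist_eq_norm, ← Function.iterate_succ_apply' s k 0] at h2
  exact absurd hk (not_lt.2 h2)

variable [NormedSpace ℝ E] [IsOrderedAddMonoid E] [HasSolidNorm E] [IsOrderedModule ℝ E]

theorem IsKBSpace.monotoneConvergesBelow (h : IsKBSpace E) (w : E) : MonotoneConvergesBelow w :=
  fun x hx h0 hw => h x hx h0 ⟨‖w‖, fun n => norm_le_norm_of_nonneg (h0 n) (hw n)⟩

/-- In a KB-space, order intervals of the bidual meet the space in order bounded sets. -/
theorem IsKBSpace.exists_upper_bound (h : IsKBSpace E) {φ : StrongDual ℝ (StrongDual ℝ E)}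
    (hφ : BidualNonneg φ) : ∃ w : E, 0 ≤ w ∧ ∀ x, DominatedBy φ 0 x → x ≤ w := by
  -- Elements below `φ` that are maximal up to `ε` exist: otherwise one could climb forever with
  -- jumps of at least `ε`, giving a bounded increasing sequence without limit. The bound `w` is the
  -- limit of the partial suprema of such elements for `ε = 1 / (n + 1)`.
  have step : ∀ ε : ℝ, 0 < ε → ∃ x : E, 0 ≤ x ∧ DominatedBy φ 0 x ∧
      ∀ y, x ≤ y → DominatedBy φ 0 y → ‖y - x‖ < ε := by
    intro ε hε
    by_contra! hc
    choose! s hs1 hs2 hs3 using hc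
    have inv : ∀ n : ℕ, 0 ≤ s^[n] 0 ∧ DominatedBy φ 0 (s^[n] 0) := by
      intro n
      induction n with
      | zero => exact ⟨le_rfl, hφ.dominatedBy_zero⟩
      | succ n ih =>
        rw [Function.iterate_succ_apply']
        exact ⟨ih.1.trans (hs1 _ ih.1 ih.2), hs2 _ ih.1 ih.2⟩
    obtain ⟨a, ha⟩ := h (fun n => s^[n] 0)
      (monotone_nat_of_le_succ fun n => by
        rw [Function.iterate_succ_apply']; exact hs1 _ (inv n).1 (inv n).2)
      (fun n => (inv n).1)
      ⟨‖φ‖ + 0, fun n => (inv n).2.norm_le le_rfl (inv n).1⟩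
    have h1 := ((ha.comp (tendsto_add_atTop_nat 1)).sub ha).norm
    rw [sub_self, norm_zero] at h1
    obtain ⟨n, hn⟩ := (h1.eventually (gt_mem_nhds hε)).exists
    have h2 := hs3 _ (inv n).1 (inv n).2
    rw [← Function.iterate_succ_apply' s n 0] at h2
    exact absurd hn (not_lt.2 h2)
  choose x hx0 hxφ hx using fun n : ℕ => step (1 / ((n : ℝ) + 1)) Nat.one_div_pos_of_nat
  have hsφ : ∀ n, DominatedBy φ 0 (partialSups x n) := by
    intro n
    induction n with
    | zero => simpa using hxφ 0
    | succ n ih => rw [partialSups_add_one]; exact ih.sup_zero (hxφ _)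
  have hs0 : ∀ n, 0 ≤ partialSups x n := fun n => (hx0 n).trans (le_partialSups x n)
  obtain ⟨w, hw⟩ := h (partialSups x) (partialSups x).monotone hs0
    ⟨‖φ‖ + 0, fun n => (hsφ n).norm_le le_rfl (hs0 n)⟩
  refine ⟨w, ge_of_tendsto' hw hs0, fun y hy => ?_⟩
  have h1 : Tendsto (fun n => (y - partialSups x n)⁺) atTop (𝓝 ((y - w)⁺)) :=
    (continuous_posPart.tendsto _).comp (tendsto_const_nhds.sub hw)
  have h2 : Tendsto (fun n => (y - partialSups x n)⁺) atTop (𝓝 0) := by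
    refine squeeze_zero_norm (fun n => ?_) tendsto_one_div_add_atTop_nhds_zero_nat
    have h3 := hx n (y ⊔ partialSups x n) ((le_partialSups x n).trans le_sup_right)
      (hy.sup_zero (hsφ n))
    refine le_trans (norm_le_norm_of_nonneg (posPart_nonneg _) ?_) h3.le
    rw [sup_eq_add_posPart_sub, le_sub_iff_add_le, add_comm]
    exact add_le_add_left (le_partialSups x n) _
  exact sub_nonpos.1 (posPart_eq_zero.1 (tendsto_nhds_unique h1 h2))

theorem DualNonneg.apply_partialSups_le {g : StrongDual ℝ E} (hg : DualNonneg g) {x : ℕ → E}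
    (hx : ∀ n, 0 ≤ x n) (m : ℕ) : g (partialSups x m) ≤ ∑ k ∈ Finset.range (m + 1), g (x k) := by
  induction m with
  | zero => simp
  | succ m ih =>
    rw [partialSups_add_one, Finset.sum_range_succ]
    have h1 : partialSups x m ⊔ x (m + 1) ≤ partialSups x m + x (m + 1) :=
      sup_le (le_add_of_nonneg_right (hx _))
        (le_add_of_nonneg_left ((hx 0).trans (le_partialSups_of_le x (Nat.zero_le m))))
    have := hg.mono h1
    rw [map_add] at this
    linarith

/-- On an order interval where increasing sequences converge, the norm is controlled by a positive
functional up to a small error. -/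
theorem MonotoneConvergesBelow.exists_norm_le {w : E} (hw : MonotoneConvergesBelow w)
    {ε : ℝ} (hε : 0 < ε) :
    ∃ g : StrongDual ℝ E, DualNonneg g ∧ ∀ x, 0 ≤ x → x ≤ w → ‖x‖ ≤ g x + ε := by
  by_contra! hc
  choose! X hX0 hXw hX using hc
  choose! G hG0 hG1 hG using fun (x : E) (hx : 0 ≤ x) => exists_dualNonneg_norming hx
  -- `S n` sums the norming functionals of the earlier counterexamples, and the next `x n` is chosen
  -- against `2 ^ n • S n`. Each earlier functional is thus at most `‖w‖ / 2 ^ n` at `x n`, while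
  -- `‖x n‖ > ε`.
  let S : ℕ → StrongDual ℝ E := fun n => Nat.rec 0 (fun n f => f + G (X ((2 : ℝ) ^ n • f))) n
  have hS : ∀ n, S (n + 1) = S n + G (X ((2 : ℝ) ^ n • S n)) := fun n => rfl
  have p2 : ∀ n : ℕ, (0 : ℝ) < 2 ^ n := fun n => by positivity
  have hSn : ∀ n, DualNonneg (S n) := by
    intro n
    induction n with
    | zero => exact DualNonneg.zero
    | succ n ih => rw [hS]; exact ih.add (hG0 _ (hX0 _ (ih.smul (p2 n).le)))
  set x : ℕ → E := fun n => X ((2 : ℝ) ^ n • S n) with hxdef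
  have hpos : ∀ n, DualNonneg ((2 : ℝ) ^ n • S n) := fun n => (hSn n).smul (p2 n).le
  have hx0 : ∀ n, 0 ≤ x n := fun n => hX0 _ (hpos n)
  have hxw : ∀ n, x n ≤ w := fun n => hXw _ (hpos n)
  have hxS : ∀ n, (2 : ℝ) ^ n * S n (x n) + ε < ‖x n‖ := fun n => hX _ (hpos n)
  have hmono : ∀ i n, i < n → ∀ y, 0 ≤ y → G (x i) y ≤ S n y := by
    intro i n hin y hy
    induction n with
    | zero => omega
    | succ n ih =>
      rw [hS, _root_.add_apply]
      rcases Nat.lt_succ_iff_lt_or_eq.1 hin with h | h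
      · have := hG0 _ (hx0 n) y hy
        linarith [ih h]
      · subst h
        have := hSn i y hy
        linarith
  have hsmall : ∀ i n, i < n → G (x i) (x n) ≤ ‖w‖ * (1 / 2) ^ n := by
    intro i n hin
    have h1 := hmono i n hin _ (hx0 n)
    have h2 := hxS n
    have h3 := norm_le_norm_of_nonneg (hx0 n) (hxw n)
    rw [one_div_pow, mul_one_div, le_div_iff₀ (p2 n)]
    nlinarith [p2 n]
  have w0 : 0 ≤ w := (hx0 0).trans (hxw 0)
  have hlim : ∀ n, ∃ z, Tendsto (partialSups fun k => x (n + k)) atTop (𝓝 z) := by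
    intro n
    refine hw _ (OrderHom.monotone _) (fun m => ?_) (fun m => ?_)
    · exact (hx0 (n + m)).trans (le_partialSups (fun k => x (n + k)) m)
    · exact partialSups_le _ _ _ fun k _ => hxw _
  -- `z n` is the supremum of the tail `x n, x (n + 1), …`. These decrease to `z 0 - b`, where every
  -- `G (x i)` is at most `0` because its values on tails are geometrically small.
  choose z hz using hlim
  have hzw : ∀ n, z n ≤ w := fun n => le_of_tendsto' (hz n) fun m =>
    partialSups_le _ _ _ fun k _ => hxw _
  have hxz : ∀ n, x n ≤ z n := fun n => ge_of_tendsto' (hz n) fun m =>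
    le_partialSups_of_le (fun k => x (n + k)) (Nat.zero_le m)
  have hz0 : ∀ n, 0 ≤ z n := fun n => (hx0 n).trans (hxz n)
  have hzanti : ∀ n, z (n + 1) ≤ z n := by
    intro n
    refine le_of_tendsto' (hz (n + 1)) fun m => ge_of_tendsto (hz n) ?_
    filter_upwards [eventually_ge_atTop (m + 1)] with l hl
    refine partialSups_le _ _ _ fun k hk => ?_
    have := le_partialSups_of_le (fun k => x (n + k)) (show k + 1 ≤ l by omega)
    simpa only [add_assoc, add_comm 1 k] using this
  have hzA : Antitone z := antitone_nat_of_succ_le hzanti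
  have hgz : ∀ i n, i < n → G (x i) (z n) ≤ 2 * ‖w‖ * (1 / 2) ^ n := by
    intro i n hin
    refine le_of_tendsto' (((G (x i)).continuous.tendsto _).comp (hz n)) fun m => ?_
    refine ((hG0 _ (hx0 i)).apply_partialSups_le (fun k => hx0 (n + k)) m).trans ?_
    have h1 : ∀ k ∈ Finset.range (m + 1),
        G (x i) (x (n + k)) ≤ ‖w‖ * (1 / 2) ^ n * (1 / 2) ^ k := by
      intro k _
      rw [mul_assoc, ← pow_add]
      exact hsmall i (n + k) (by omega)
    refine (Finset.sum_le_sum h1).trans ?_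
    rw [← Finset.mul_sum]
    have h2 := sum_geometric_two_le (m + 1)
    have h3 : 0 ≤ ‖w‖ * (1 / 2 : ℝ) ^ n := by positivity
    nlinarith
  obtain ⟨b, hb⟩ := hw (fun n => z 0 - z n)
    (fun m n hmn => sub_le_sub_left (hzA hmn) _)
    (fun n => sub_nonneg.2 (hzA (Nat.zero_le n)))
    (fun n => (sub_le_self _ (hz0 n)).trans (hzw 0))
  have hzc : Tendsto z atTop (𝓝 (z 0 - b)) := by
    have := (tendsto_const_nhds (x := z 0)).sub hb
    simpa using this
  have hgc : ∀ i, G (x i) (z 0 - b) ≤ 0 := by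
    intro i
    have h1 : Tendsto (fun n : ℕ => 2 * ‖w‖ * (1 / 2 : ℝ) ^ n) atTop (𝓝 0) := by
      simpa using (tendsto_pow_atTop_nhds_zero_of_lt_one (r := (1 / 2 : ℝ)) (by norm_num)
        (by norm_num)).const_mul (2 * ‖w‖)
    refine le_of_tendsto_of_tendsto (((G (x i)).continuous.tendsto _).comp hzc) h1 ?_
    filter_upwards [eventually_gt_atTop i] with n hn using hgz i n hn
  -- `G (x n)` has norm at most one and separates: it is at least `‖x n‖ > ε` at `z n` and at most
  -- `0` at the limit, which contradicts convergence.
  have hfin : ∀ n, ε ≤ ‖z n - (z 0 - b)‖ := by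
    intro n
    have h1 : ε < ‖x n‖ := by
      have := mul_nonneg (p2 n).le (hSn n _ (hx0 n))
      linarith [hxS n]
    rw [← hG _ (hx0 n)] at h1
    have h2 := (hG0 _ (hx0 n)).mono (hxz n)
    have h3 := hgc n
    have h4 : G (x n) (z n - (z 0 - b)) ≤ ‖G (x n)‖ * ‖z n - (z 0 - b)‖ :=
      (le_abs_self _).trans ((G (x n)).le_opNorm _)
    have h5 := mul_le_mul_of_nonneg_right (hG1 _ (hx0 n)) (norm_nonneg (z n - (z 0 - b)))
    rw [map_sub] at h4
    linarith
  have h6 := (hzc.sub_const (z 0 - b)).norm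
  rw [sub_self, norm_zero] at h6
  exact absurd (ge_of_tendsto' h6 hfin) (not_le.2 hε)

end OrderContinuity

/-! ### Uniform convexity as a substitute for weak compactness -/

section CommonPoint

variable {E : Type u} [NormedAddCommGroup E] [NormedSpace ℝ E] [Lattice E]
  [IsOrderedAddMonoid E] [IsOrderedModule ℝ E]

/-- A discretisation of `y ↦ ∫₀¹ g ((y - t x)⁺) dt`, a uniformly convex function on `[0, x]` up to
the mesh of the grid. -/
noncomputable def gridSum (g : StrongDual ℝ E) (x : E) (N : ℕ) (y : E) : ℝ :=
  ∑ k ∈ Finset.range (N + 1), g (y - ((k : ℝ) / N) • x)⁺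

theorem gridSum_nonneg {g : StrongDual ℝ E} (hg : DualNonneg g) (x : E) (N : ℕ) (y : E) :
    0 ≤ gridSum g x N y :=
  Finset.sum_nonneg fun _ _ => hg _ (posPart_nonneg _)

theorem gridSum_le {g : StrongDual ℝ E} (hg : DualNonneg g) {x y : E} (hx : 0 ≤ x) (N : ℕ)
    (hy : y ≤ x) : gridSum g x N y ≤ (N + 1) * g x := by
  refine (Finset.sum_le_card_nsmul _ _ (g x) fun k _ => hg.mono (sup_le ?_ hx)).trans_eq ?_
  · exact (sub_le_self _ (smul_nonneg (by positivity) hx)).trans hy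
  · simp

/-- The midpoint defect of `gridSum` bounds `g s`, where `s` sums the overlaps `(y - t k)⁺ ⊓ (t k -
z)⁺` over the grid (`posPart_inf_posPart_neg_le`). Each overlap is below `s`, so `sub_le_of_levels`
bounds `y - z` by the mesh `x / N` plus `2 s`. -/
theorem apply_posPart_sub_le_gridSum {g : StrongDual ℝ E} (hg : DualNonneg g) {x y z : E}
    (hx : 0 ≤ x) {N : ℕ} (hN : 0 < N) (hy : y ≤ x) (hz : 0 ≤ z) :
    g (y - z)⁺ ≤ g x / N + 2 * (gridSum g x N y + gridSum g x N z
      - 2 * gridSum g x N ((1 / 2 : ℝ) • (y + z))) := by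
  have hN' : (N : ℝ) ≠ 0 := by positivity
  set t : ℕ → E := fun k => ((k : ℝ) / N) • x with ht
  set s : E := ∑ k ∈ Finset.range (N + 1), (y - t k)⁺ ⊓ (t k - z)⁺ with hs
  have hterm : ∀ k, 0 ≤ (y - t k)⁺ ⊓ (t k - z)⁺ := fun k =>
    le_inf (posPart_nonneg _) (posPart_nonneg _)
  have hs0 : 0 ≤ s := Finset.sum_nonneg fun k _ => hterm k
  have hd0 : 0 ≤ (1 / (N : ℝ)) • x := smul_nonneg (by positivity) hx
  have h1 : y - z ≤ (1 / (N : ℝ)) • x + s + s := by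
    refine sub_le_of_levels (t := t) (N := N) ?_ ?_ ?_ hd0 hs0 ?_
    · simpa [ht] using hz
    · simpa [ht, div_self hN'] using hy
    · intro k _
      refine le_of_eq ?_
      simp only [ht]
      rw [← add_smul]; push_cast; rw [add_div]
    · intro k hk
      exact Finset.single_le_sum (f := fun k => (y - t k)⁺ ⊓ (t k - z)⁺) (fun k _ => hterm k)
        (Finset.mem_range.2 (by omega))
  have h2 : (y - z)⁺ ≤ (1 / (N : ℝ)) • x + s + s :=
    sup_le h1 (add_nonneg (add_nonneg hd0 hs0) hs0)
  have h3 := hg.mono h2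
  have h4 : g s ≤ gridSum g x N y + gridSum g x N z
      - 2 * gridSum g x N ((1 / 2 : ℝ) • (y + z)) := by
    rw [hs, map_sum, gridSum, gridSum, gridSum, Finset.mul_sum, ← Finset.sum_add_distrib,
      ← Finset.sum_sub_distrib]
    refine Finset.sum_le_sum fun k _ => ?_
    have h5 := hg.mono (posPart_inf_posPart_neg_le (y - t k) (z - t k))
    rw [neg_sub, map_sub, map_add] at h5
    have h6 : (y - t k + (z - t k))⁺ = (2 : ℝ) • ((1 / 2 : ℝ) • (y + z) - t k)⁺ := by
      rw [← posPart_smul two_pos]; congr 1; module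
    rw [h6, map_smul, smul_eq_mul] at h5
    exact h5
  rw [map_add, map_add, map_smul, smul_eq_mul] at h3
  rw [div_eq_inv_mul, ← one_div]
  linarith

variable [HasSolidNorm E]

/-- A downward directed family of convex subsets of `[0, x]` has approximate common points. -/
theorem MonotoneConvergesBelow.exists_approx_common_point {x : E} (hx : MonotoneConvergesBelow x)
    (hx0 : 0 ≤ x) {ι : Type*} [Nonempty ι] {K : ι → Set E}
    (hdir : ∀ i j, ∃ l, K l ⊆ K i ∧ K l ⊆ K j) (hconv : ∀ i, Convex ℝ (K i))
    (hne : ∀ i, (K i).Nonempty) (hsub : ∀ i, K i ⊆ Set.Icc 0 x) {ε : ℝ} (hε : 0 < ε) :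
    ∃ i, ∃ y ∈ K i, ∀ j, ∃ z ∈ K j, ‖y - z‖ ≤ ε := by
  obtain ⟨g, hg, hgx⟩ := hx.exists_norm_le (ε := ε / 4) (by positivity)
  have hgx0 : 0 ≤ g x := hg x hx0
  obtain ⟨N, hN⟩ := exists_nat_gt (g x / (ε / 8))
  have hN0 : 0 < N := by
    have : (0 : ℝ) < N := lt_of_le_of_lt (by positivity) hN
    exact_mod_cast this
  have hN' : (0 : ℝ) < N := by exact_mod_cast hN0
  have hgN : g x / N ≤ ε / 8 := by
    rw [div_lt_iff₀ (by positivity)] at hN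
    rw [div_le_iff₀ hN']; linarith
  set F := gridSum g x N
  -- `sSup V` is the supremum over `i` of the infimum of `F` on `K i`. Near-minimisers taken from a
  -- `K i` almost attaining it, and from any smaller member, have their midpoint in `K i`, so the
  -- midpoint defect of `F` is small and they are close in norm.
  let V : Set ℝ := {r | ∃ i, ∀ y ∈ K i, r ≤ F y}
  have hVb : BddAbove V := by
    refine ⟨(N + 1) * g x, ?_⟩
    rintro r ⟨i, hi⟩
    obtain ⟨y, hy⟩ := hne i
    exact (hi y hy).trans (gridSum_le hg hx0 N (hsub i hy).2)
  have hVn : V.Nonempty := ⟨0, Classical.arbitrary ι, fun y _ => gridSum_nonneg hg x N y⟩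
  -- A defect of `4 * η` contributes `8 * η = ε / 8`. With `ε / 8` for the mesh and `ε / 4` for the
  -- passage from `g` to the norm, each of `(y - z)⁺` and `(z - y)⁺` has norm at most `ε / 2`.
  set η := ε / 64 with hη
  have hη0 : 0 < η := by positivity
  obtain ⟨r, ⟨i, hi⟩, hr⟩ := exists_lt_of_lt_csSup hVn (sub_lt_self (sSup V) hη0)
  have hM : ∀ l, ∃ z ∈ K l, F z < sSup V + η := by
    intro l
    by_contra! h
    have : sSup V + η ≤ sSup V := le_csSup hVb ⟨l, h⟩
    linarith
  obtain ⟨y, hy, hFy⟩ := hM i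
  refine ⟨i, y, hy, fun j => ?_⟩
  obtain ⟨l, hli, hlj⟩ := hdir i j
  obtain ⟨z, hz, hFz⟩ := hM l
  refine ⟨z, hlj hz, ?_⟩
  have hmid : (1 / 2 : ℝ) • (y + z) ∈ K i := by
    rw [smul_add]
    exact hconv i hy (hli hz) (by norm_num) (by norm_num) (by norm_num)
  have hFm := hi _ hmid
  have key : ∀ a b : E, 0 ≤ a → a ≤ x → 0 ≤ b → F a + F b - 2 * F ((1 / 2 : ℝ) • (a + b)) ≤ 4 * η →
      ‖(a - b)⁺‖ ≤ ε / 2 := by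
    intro a b ha hax hb hF
    have h1 := apply_posPart_sub_le_gridSum hg hx0 hN0 hax hb
    have h2 := hgx _ (posPart_nonneg (a - b)) (sup_le ((sub_le_self _ hb).trans hax) hx0)
    change g (a - b)⁺ ≤ g x / N + 2 * (F a + F b - 2 * F ((1 / 2 : ℝ) • (a + b))) at h1
    linarith
  have k1 := key y z (hsub i hy).1 (hsub i hy).2 (hsub l hz).1 (by linarith)
  have k2 := key z y (hsub l hz).1 (hsub l hz).2 (hsub i hy).1 (by rw [add_comm z y]; linarith)
  rw [← posPart_sub_negPart (y - z)]
  refine (norm_sub_le _ _).trans ?_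
  rw [← posPart_neg, neg_sub]
  linarith

end CommonPoint

/-! ### Truncating an element of `E` by an element of the bidual -/

section Truncation

variable {E : Type u} [NormedAddCommGroup E] [NormedSpace ℝ E] [Lattice E]
  [IsOrderedAddMonoid E] [IsOrderedModule ℝ E] [HasSolidNorm E]
  {φ : StrongDual ℝ (StrongDual ℝ E)}

/-- Finitely many of the inequalities that say that `y ∈ [0, x]` lies below `φ` and near `x` can be
solved approximately. -/
theorem DominatedBy.exists_finite_truncation (hφ : BidualNonneg φ) {c : ℝ} (hc : 0 ≤ c)
    {x : E} (hx0 : 0 ≤ x) (hx : DominatedBy φ c x) {κ : Type*} [Finite κ] (f : κ → StrongDual ℝ E)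
    (hf : ∀ i, DualNonneg (f i)) {η : ℝ} (hη : 0 < η) :
    ∃ y, 0 ≤ y ∧ y ≤ x ∧ ‖x - y‖ ≤ c + η ∧ ∀ i, f i y ≤ φ (f i) + η := by
  classical
  have := Fintype.ofFinite κ
  by_contra! hcon
  -- `A` holds the admissible errors and functional values, `B` those achieved by some `a ≥ 0`. At a
  -- common point, `a ⊓ x` would solve the problem; so under `hcon` the two convex sets are disjoint
  -- and can be separated.
  let A : Set (E × (κ → ℝ)) := {p | ‖p.1‖ < c + η ∧ ∀ i, p.2 i < φ (f i) + η}
  let B : Set (E × (κ → ℝ)) := {p | ∃ a, 0 ≤ a ∧ x ≤ a + p.1 ∧ ∀ i, f i a ≤ p.2 i}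
  have hA : IsOpen A := by
    have e : A = {p | ‖p.1‖ < c + η} ∩ ⋂ i, {p | p.2 i < φ (f i) + η} := by
      ext p; simp [A]
    rw [e]
    exact (isOpen_lt continuous_fst.norm continuous_const).inter (isOpen_iInter_of_finite fun i =>
      isOpen_lt ((continuous_apply i).comp continuous_snd) continuous_const)
  have hAc : Convex ℝ A := by
    rintro p ⟨h1, h2⟩ q ⟨h3, h4⟩ a b ha hb hab
    constructor
    · have := convex_ball (0 : E) (c + η) (mem_ball_zero_iff.2 h1) (mem_ball_zero_iff.2 h3)
        ha hb hab
      exact mem_ball_zero_iff.1 this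
    · intro i
      exact convex_Iio (φ (f i) + η) (h2 i) (h4 i) ha hb hab
  have hBc : Convex ℝ B := by
    rintro p ⟨y, h1, h2, h3⟩ q ⟨z, h4, h5, h6⟩ a b ha hb hab
    refine ⟨a • y + b • z, add_nonneg (smul_nonneg ha h1) (smul_nonneg hb h4), ?_, fun i => ?_⟩
    · calc x = a • x + b • x := by rw [← add_smul, hab, one_smul]
        _ ≤ a • (y + p.1) + b • (z + q.1) :=
          add_le_add (smul_le_smul_of_nonneg_left h2 ha) (smul_le_smul_of_nonneg_left h5 hb)
        _ = _ := by simp only [Prod.fst_add, Prod.smul_fst]; module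
    · simp only [map_add, map_smul, smul_eq_mul, Prod.snd_add, Prod.smul_snd, Pi.add_apply,
        Pi.smul_apply]
      exact add_le_add (mul_le_mul_of_nonneg_left (h3 i) ha) (mul_le_mul_of_nonneg_left (h6 i) hb)
  have hdis : Disjoint A B := by
    rw [Set.disjoint_left]
    rintro ⟨b, v⟩ ⟨h1, h2⟩ ⟨a, ha, hab, hv⟩
    simp only at h1 h2 hab hv
    obtain ⟨i, hi⟩ := hcon (a ⊓ x) (le_inf ha hx0) inf_le_right (by
      have h3 : x - a ⊓ x = (x - a)⁺ := by
        rw [inf_comm, inf_eq_sub_posPart_sub]; abel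
      rw [h3]
      refine le_trans ?_ h1.le
      rw [← norm_abs_eq_norm b]
      exact norm_le_norm_of_nonneg (posPart_nonneg _)
        (sup_le ((sub_le_iff_le_add'.2 hab).trans (le_abs_self b)) (abs_nonneg b)))
    have h4 := (hf i).mono (inf_le_left : a ⊓ x ≤ a)
    linarith [h2 i, hv i]
  obtain ⟨L, r, hL1, hL2⟩ := geometric_hahn_banach_open hAc hA hBc hdis
  let h : StrongDual ℝ E := L.comp (ContinuousLinearMap.inl ℝ E (κ → ℝ))
  let l : κ → ℝ := fun i => L (0, Pi.single i 1)
  have hL : ∀ b v, L (b, v) = h b + ∑ i, v i * l i := by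
    intro b v
    have e1 : (b, v) = (b, (0 : κ → ℝ)) + ∑ i, v i • ((0 : E), (Pi.single i 1 : κ → ℝ)) := by
      ext j
      · simp [Prod.fst_sum]
      · simp [Prod.snd_sum, Finset.sum_apply, Pi.single_apply]
    rw [e1, map_add, map_sum]
    simp only [map_smul, smul_eq_mul]
    rfl
  -- `B` contains the ray from `(x, 0)` in the direction `(b, v)`, and `L` is bounded below on `B`.
  have hbig : ∀ b v, 0 ≤ b → (∀ i, 0 ≤ v i) → 0 ≤ L (b, v) := by
    intro b v hb hv
    by_contra! hneg
    obtain ⟨n, hn⟩ := exists_nat_gt ((L (x, 0) - r) / -L (b, v))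
    rw [div_lt_iff₀ (by linarith)] at hn
    have h1 := hL2 ((x, 0) + (n : ℝ) • (b, v)) ⟨0, le_rfl, by
      simpa using smul_nonneg (Nat.cast_nonneg n) hb, fun i => by
      simpa using mul_nonneg (Nat.cast_nonneg n) (hv i)⟩
    rw [map_add, map_smul, smul_eq_mul] at h1
    linarith
  have hl : ∀ i, 0 ≤ l i := fun i => hbig _ _ le_rfl fun j => by
    rw [Pi.single_apply]; split_ifs <;> norm_num
  have hh : DualNonneg h := fun b hb => hbig b 0 hb fun _ => le_rfl
  set F : StrongDual ℝ E := ∑ i, l i • f i with hF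
  have hFa : ∀ a, F a = ∑ i, f i a * l i := by
    intro a
    simp [hF, mul_comm]
  -- The same ray argument, with witness `n • a` in `B`.
  have hhF : DualNonneg (F - h) := by
    intro a ha
    by_contra! hneg
    obtain ⟨n, hn⟩ := exists_nat_gt ((h x - r) / -((F - h) a))
    rw [div_lt_iff₀ (by linarith)] at hn
    have h1 := hL2 (x - (n : ℝ) • a, fun i => f i ((n : ℝ) • a))
      ⟨(n : ℝ) • a, smul_nonneg (Nat.cast_nonneg n) ha, by simp, fun i => le_rfl⟩
    rw [hL, ← hFa, map_sub, map_smul, map_smul, smul_eq_mul, smul_eq_mul] at h1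
    rw [_root_.sub_apply] at hn
    linarith
  have hr : r ≤ h x := by
    have := hL2 (x, 0) ⟨0, le_rfl, by simp, fun i => by simp⟩
    rwa [hL, show ∑ i, (0 : κ → ℝ) i * l i = 0 by simp, add_zero] at this
  have hFφ : φ F = ∑ i, φ (f i) * l i := by
    simp [hF, mul_comm]
  have hhφ : φ h ≤ φ F := by
    have : 0 ≤ φ (F - h) := hφ (F - h) hhF
    rw [map_sub] at this
    exact sub_nonneg.1 this
  -- Separation gives `h b + φ F < h x ≤ φ h + c * ‖h‖`, and `φ h ≤ φ F`. Taking the supremum over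
  -- `b` would give `(c + η) * ‖h‖ ≤ c * ‖h‖`, so `h = 0`; then `b = 0` yields `0 < 0`.
  have hb : ∀ b, ‖b‖ < c + η → h b < c * ‖h‖ := by
    intro b hb
    have h1 := hL1 (b, fun i => φ (f i)) ⟨hb, fun i => by simpa using hη⟩
    rw [hL, ← hFφ] at h1
    have h2 := hx h hh
    linarith
  have hn : ‖h‖ = 0 := by
    by_contra hne
    have hpos : 0 < ‖h‖ := lt_of_le_of_ne (norm_nonneg _) (Ne.symm hne)
    obtain ⟨b, hb1, hb2⟩ := h.exists_lt_apply_of_lt_opNorm (r := c / (c + η) * ‖h‖)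
      (by
        rw [div_mul_eq_mul_div, div_lt_iff₀ (by linarith)]
        nlinarith)
    have hcη : 0 < c + η := by linarith
    have h3 : ∀ s : ℝ, |s| = 1 → h ((s * (c + η)) • b) < c * ‖h‖ := fun s hs => hb _ (by
      rw [norm_smul, norm_mul, Real.norm_eq_abs, hs, one_mul, Real.norm_of_nonneg hcη.le]
      nlinarith)
    have h4 := h3 1 (by simp)
    have h5 := h3 (-1) (by simp)
    rw [map_smul, smul_eq_mul] at h4 h5
    have h6 : (c + η) * |h b| < c * ‖h‖ := by
      rcases abs_cases (h b) with ⟨h7, -⟩ | ⟨h7, -⟩ <;> rw [h7] <;> linarith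
    rw [Real.norm_eq_abs, div_mul_eq_mul_div, div_lt_iff₀ hcη] at hb2
    linarith
  have h0 := hb 0 (by rw [norm_zero]; linarith)
  rw [map_zero, hn, mul_zero] at h0
  exact lt_irrefl _ h0

/-- If order intervals are well behaved, an element of `[0, x]` almost below `φ` can be found as
close to `x` as the distance from `x` to the elements of the bidual below `φ`. -/
theorem MonotoneConvergesBelow.exists_truncation {x : E} (hx : MonotoneConvergesBelow x)
    (hx0 : 0 ≤ x) (hφ : BidualNonneg φ) {c : ℝ} (hc : 0 ≤ c) (hxc : DominatedBy φ c x)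
    {δ : ℝ} (hδ : 0 < δ) :
    ∃ y, 0 ≤ y ∧ y ≤ x ∧ DominatedBy φ δ y ∧ ‖x - y‖ ≤ c + δ := by
  classical
  let K : Finset {f : StrongDual ℝ E // DualNonneg f} → Set E := fun I =>
    {y | 0 ≤ y ∧ y ≤ x ∧ ‖x - y‖ ≤ c + δ ∧ ∀ f : I, (f : {f // DualNonneg f}).1 y ≤
      φ (f : {f // DualNonneg f}).1 + δ}
  have hanti : ∀ I J, I ⊆ J → K J ⊆ K I := fun I J h y hy =>
    ⟨hy.1, hy.2.1, hy.2.2.1, fun f => hy.2.2.2 ⟨f, h f.2⟩⟩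
  obtain ⟨I, y, hy, hyz⟩ := hx.exists_approx_common_point hx0 (K := K)
    (fun I J => ⟨I ∪ J, hanti _ _ Finset.subset_union_left, hanti _ _ Finset.subset_union_right⟩)
    (fun I => by
      rintro p ⟨h1, h2, h3, h4⟩ q ⟨h5, h6, h7, h8⟩ a b ha hb hab
      have i1 := convex_Icc (𝕜 := ℝ) 0 x ⟨h1, h2⟩ ⟨h5, h6⟩ ha hb hab
      refine ⟨i1.1, i1.2, ?_, fun f => ?_⟩
      · have := convex_closedBall x (c + δ) (mem_closedBall_iff_norm'.2 h3)
          (mem_closedBall_iff_norm'.2 h7) ha hb hab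
        exact mem_closedBall_iff_norm'.1 this
      · rw [map_add, map_smul, map_smul]
        exact convex_Iic (𝕜 := ℝ) (φ (f : {f // DualNonneg f}).1 + δ) (h4 f) (h8 f) ha hb hab)
    (fun I => by
      obtain ⟨y, h1, h2, h3, h4⟩ := hxc.exists_finite_truncation hφ hc hx0
        (fun f : I => (f : {f // DualNonneg f}).1) (fun f => f.1.2) hδ
      exact ⟨y, h1, h2, h3, h4⟩)
    (fun I y hy => ⟨hy.1, hy.2.1⟩) hδ
  refine ⟨y, hy.1, hy.2.1, fun f hf => ?_, hy.2.2.1⟩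
  -- Testing with `(n + 1) • f` divides the additive error `δ` by `n + 1`; the distance from `y` to
  -- the corresponding set costs only `δ * ‖f‖`.
  have h1 : ∀ n : ℕ, f y ≤ φ f + δ * ‖f‖ + δ * (1 / ((n : ℝ) + 1)) := by
    intro n
    have hn : (0 : ℝ) < (n : ℝ) + 1 := by positivity
    obtain ⟨z, hz, hyz⟩ := hyz {⟨((n : ℝ) + 1) • f, hf.smul hn.le⟩}
    have h2 := hz.2.2.2 ⟨_, Finset.mem_singleton_self _⟩
    simp only [_root_.smul_apply, map_smul, smul_eq_mul] at h2
    have h3 : f (y - z) ≤ ‖f‖ * ‖y - z‖ := (le_abs_self _).trans (f.le_opNorm _)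
    have h4 := mul_le_mul_of_nonneg_left hyz (norm_nonneg f)
    rw [map_sub] at h3
    have h5 : f z ≤ φ f + δ * (1 / ((n : ℝ) + 1)) := by
      rw [mul_one_div, ← sub_le_iff_le_add', le_div_iff₀ hn]
      linarith
    linarith
  have h2 : Tendsto (fun n : ℕ => φ f + δ * ‖f‖ + δ * (1 / ((n : ℝ) + 1))) atTop
      (𝓝 (φ f + δ * ‖f‖)) := by
    simpa using (tendsto_one_div_add_atTop_nhds_zero_nat.const_mul δ).const_add (φ f + δ * ‖f‖)
  exact ge_of_tendsto' h2 h1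

end Truncation

/-! ### L-weak compactness of b-semi compact sets -/

section Disjoint

variable {E : Type u} [NormedAddCommGroup E] [NormedSpace ℝ E] [Lattice E]
  [IsOrderedAddMonoid E] [IsOrderedModule ℝ E] [HasSolidNorm E]

/-- Both `a` and `-a` are below `φ` up to `ε`, and the supremum adds the two errors. -/
theorem IsBSemiCompact.exists_dominatedBy {S : Set E} (hS : IsBSemiCompact S) {ε : ℝ}
    (hε : 0 < ε) : ∃ φ : StrongDual ℝ (StrongDual ℝ E), BidualNonneg φ ∧
      ∀ x ∈ solidClosure S, DominatedBy φ (ε + ε) |x| := by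
  obtain ⟨φ, hφ, h⟩ := hS ε hε
  refine ⟨φ, hφ, ?_⟩
  rintro x ⟨a, ha, hxa⟩
  obtain ⟨ψ, ⟨h1, h2⟩, h3⟩ := h a ha
  refine DominatedBy.of_le (DominatedBy.sup hε.le hε.le ?_ ?_) hxa
  all_goals
    intro f hf
    have h4 := (NormedSpace.inclusionInDoubleDual ℝ E a - ψ).le_opNorm f
    have h5 := mul_le_mul_of_nonneg_right h3 (norm_nonneg f)
    rw [_root_.sub_apply, NormedSpace.dual_def, Real.norm_eq_abs] at h4
    have h6 := abs_le.1 (h4.trans h5)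
    have h7 := h1 f hf
    have h8 := h2 f hf
    rw [_root_.neg_apply] at h7
  · linarith [h6.2]
  · rw [map_neg]; linarith [h6.1]

theorem subset_solidClosure_self (S : Set E) : S ⊆ solidClosure S :=
  fun x hx => ⟨x, hx, le_rfl⟩

theorem IsKBSpace.isLWeaklyCompact (h : IsKBSpace E) {S : Set E} (hS : IsBSemiCompact S) :
    IsLWeaklyCompact S := by
  constructor
  · obtain ⟨φ, -, h1⟩ := hS.exists_dominatedBy one_pos
    refine isBounded_iff_forall_norm_le.2 ⟨‖φ‖ + (1 + 1), fun x hx => ?_⟩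
    rw [← norm_abs_eq_norm]
    exact (h1 x (subset_solidClosure_self S hx)).norm_le (by norm_num) (abs_nonneg x)
  intro x hxS hdis
  rw [NormedAddGroup.tendsto_nhds_zero]
  intro ε hε
  obtain ⟨φ, hφ, h1⟩ := hS.exists_dominatedBy (ε := ε / 8) (by positivity)
  -- The errors must be summable because suprema add them. The truncations `y n` stay within `ε / 4
  -- + δ n ≤ ε / 2` of `|x n|`.
  let δ : ℕ → ℝ := fun n => ε / 4 * (1 / 2) ^ n
  have hδ0 : ∀ n, 0 < δ n := fun n => by positivity
  have hδ1 : ∀ n, δ n ≤ ε / 4 := fun n =>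
    mul_le_of_le_one_right (by positivity) (pow_le_one₀ (by norm_num) (by norm_num))
  choose y hy0 hyx hyφ hyn using fun n => (h.monotoneConvergesBelow |x n|).exists_truncation
    (abs_nonneg _) hφ (by positivity) (h1 _ (hxS n)) (hδ0 n)
  have hyd : ∀ m n, m ≠ n → y m ⊓ y n = 0 := fun m n hmn =>
    le_antisymm ((inf_le_inf (hyx m) (hyx n)).trans (hdis hmn).le) (le_inf (hy0 m) (hy0 n))
  let s : ℕ → E := fun N => ∑ k ∈ Finset.range N, y k
  have hs1 : ∀ N, s (N + 1) = s N + y N := fun N => Finset.sum_range_succ _ _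
  have hs0 : ∀ N, 0 ≤ s N := fun N => Finset.sum_nonneg fun k _ => hy0 k
  have hsy : ∀ N n, N ≤ n → s N ⊓ y n = 0 := by
    intro N
    induction N with
    | zero => intro n _; simpa [s] using hy0 n
    | succ N ih =>
      intro n hn
      refine le_antisymm ?_ (le_inf (hs0 _) (hy0 n))
      rw [inf_comm, hs1]
      refine (inf_add_le_inf_add_inf (hy0 n) (hs0 N) (hy0 N)).trans_eq ?_
      rw [inf_comm, ih n (by omega), hyd n N (by omega), add_zero]
  have hsφ : ∀ N, DominatedBy φ (∑ k ∈ Finset.range N, δ k) (s N) := by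
    intro N
    induction N with
    | zero => simpa [s] using hφ.dominatedBy_zero
    | succ N ih =>
      -- Sums of disjoint positive elements are suprema, so domination by `φ` survives and the
      -- partial sums stay norm bounded.
      have h2 : s (N + 1) = s N ⊔ y N := by
        rw [hs1, ← inf_add_sup, hsy N N le_rfl, zero_add]
      rw [h2, Finset.sum_range_succ]
      exact ih.sup (Finset.sum_nonneg fun k _ => (hδ0 k).le) (hδ0 N).le (hyφ N)
  have hsn : ∀ N, ‖s N‖ ≤ ‖φ‖ + ε / 4 * 2 := by
    intro N
    refine ((hsφ N).norm_le (Finset.sum_nonneg fun k _ => (hδ0 k).le) (hs0 N)).trans ?_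
    rw [← Finset.mul_sum]
    gcongr
    exact sum_geometric_two_le N
  obtain ⟨a, ha⟩ := h s (monotone_nat_of_le_succ fun n => by
    rw [hs1]; exact le_add_of_nonneg_right (hy0 n)) hs0 ⟨_, hsn⟩
  have hy : Tendsto y atTop (𝓝 0) := by
    have := (ha.comp (tendsto_add_atTop_nat 1)).sub ha
    rw [sub_self] at this
    refine this.congr fun n => ?_
    simp [hs1]
  filter_upwards [(NormedAddGroup.tendsto_nhds_zero.1 hy) (ε / 4) (by positivity)] with n hn
  have h2 := hyn n
  have h3 := norm_sub_norm_le |x n| (y n)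
  rw [norm_abs_eq_norm] at h3
  linarith [hδ1 n]

/-! ### Extraction of disjoint sequences -/

theorem inf_smul_le {a b : E} (ha : 0 ≤ a) {c : ℝ} (hc : 1 ≤ c) : a ⊓ c • b ≤ c • (a ⊓ b) := by
  have h1 : c • (a ⊓ b) = c • a ⊓ c • b :=
    OrderIso.map_inf (OrderIso.smulRight (zero_lt_one.trans_le hc) : E ≃o E) a b
  rw [h1]
  refine inf_le_inf_right _ ?_
  calc a = (1 : ℝ) • a := (one_smul _ _).symm
    _ ≤ c • a := smul_le_smul_of_nonneg_right hc ha

theorem inf_sum_le {a : E} (ha : 0 ≤ a) {b : ℕ → E} (hb : ∀ n, 0 ≤ b n) (N : ℕ) :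
    a ⊓ ∑ n ∈ Finset.range N, b n ≤ ∑ n ∈ Finset.range N, a ⊓ b n := by
  induction N with
  | zero => simp
  | succ N ih =>
    rw [Finset.sum_range_succ, Finset.sum_range_succ]
    exact (inf_add_le_inf_add_inf ha (Finset.sum_nonneg fun k _ => hb k) (hb N)).trans
      (add_le_add_left ih _)

theorem sub_posPart_sub (a b : E) : a - (a - b)⁺ = a ⊓ b :=
  (inf_eq_sub_posPart_sub a b).symm

variable [CompleteSpace E]

/-- A bounded positive sequence with almost disjoint terms is a small perturbation of a disjoint
sequence. -/
theorem exists_disjoint_of_inf_small {u : ℕ → E} (hu0 : ∀ n, 0 ≤ u n) {C : ℝ}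
    (hC : ∀ n, ‖u n‖ ≤ C)
    (hsmall : ∀ n m, n < m → ‖u n ⊓ u m‖ ≤ (1 / 8) ^ m / ((m : ℝ) + 1)) :
    ∃ z : ℕ → E, (∀ n, 0 ≤ z n) ∧ (∀ n, z n ≤ u n) ∧ (Pairwise fun m n => z m ⊓ z n = 0) ∧
      Tendsto (fun n => u n - z n) atTop (𝓝 0) := by
  have hsum : Summable fun n : ℕ => ((1 / 2 : ℝ) ^ n) • u n := by
    refine Summable.of_norm_bounded (g := fun n : ℕ => (1 / 2 : ℝ) ^ n * C)
      (summable_geometric_two.mul_right C) fun n => ?_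
    rw [norm_smul, norm_pow, Real.norm_of_nonneg (by norm_num : (0 : ℝ) ≤ 1 / 2)]
    gcongr
    exact hC n
  set w : E := ∑' n : ℕ, ((1 / 2 : ℝ) ^ n) • u n with hw
  have hterm : ∀ n : ℕ, 0 ≤ ((1 / 2 : ℝ) ^ n) • u n := fun n => smul_nonneg (by positivity) (hu0 n)
  have hw0 : 0 ≤ w := tsum_nonneg hterm
  have huw : ∀ n : ℕ, ((1 / 2 : ℝ) ^ n) • u n ≤ w := fun n => hsum.le_tsum n fun k _ => hterm k
  -- The disjoint terms are `(u m - q m)⁺`. For `n < m`, `q m` exceeds `4 ^ m • u n` through its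
  -- first summand, and `q n` exceeds `4⁻ᵐ • u m` through its second, so the two parts lie under
  -- opposite parts of `4 ^ m • u n - u m`. The loss `u m ⊓ q m` is small since `4 ^ m` times the
  -- overlap bound `(1 / 8) ^ m` is `(1 / 2) ^ m`.
  let q : ℕ → E := fun m =>
    (4 : ℝ) ^ m • ∑ n ∈ Finset.range m, u n + (1 / 2 : ℝ) ^ m • w
  have hq1 : ∀ m, 0 ≤ (4 : ℝ) ^ m • ∑ n ∈ Finset.range m, u n := fun m =>
    smul_nonneg (by positivity) (Finset.sum_nonneg fun k _ => hu0 k)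
  have hq2 : ∀ m : ℕ, 0 ≤ (1 / 2 : ℝ) ^ m • w := fun m => smul_nonneg (by positivity) hw0
  have hq0 : ∀ m, 0 ≤ q m := fun m => add_nonneg (hq1 m) (hq2 m)
  have hlt : ∀ n m, n < m → (u n - q n)⁺ ⊓ (u m - q m)⁺ = 0 := by
    intro n m hnm
    refine le_antisymm ?_ (le_inf (posPart_nonneg _) (posPart_nonneg _))
    rw [← posPart_inf_posPart_neg ((4 : ℝ) ^ m • u n - u m), neg_sub]
    refine inf_le_inf ?_ (posPart_mono (sub_le_sub_left ?_ _))
    · have h1 : ((1 / 4 : ℝ) ^ m) • u m ≤ q n := by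
        calc ((1 / 4 : ℝ) ^ m) • u m ≤ ((1 / 2 : ℝ) ^ n * (1 / 2) ^ m) • u m := by
              refine smul_le_smul_of_nonneg_right ?_ (hu0 m)
              calc (1 / 4 : ℝ) ^ m = (1 / 2) ^ m * (1 / 2) ^ m := by rw [← mul_pow]; norm_num
                _ ≤ _ := by
                  gcongr ?_ * _
                  exact pow_le_pow_of_le_one (by norm_num) (by norm_num) hnm.le
          _ = (1 / 2 : ℝ) ^ n • ((1 / 2 : ℝ) ^ m • u m) := mul_smul _ _ _
          _ ≤ (1 / 2 : ℝ) ^ n • w := smul_le_smul_of_nonneg_left (huw m) (by positivity)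
          _ ≤ q n := le_add_of_nonneg_left (hq1 n)
      have h2 : (u n - q n)⁺ ≤ (u n - ((1 / 4 : ℝ) ^ m) • u m)⁺ :=
        posPart_mono (sub_le_sub_left h1 _)
      refine h2.trans ?_
      have h3 : (4 : ℝ) ^ m • u n - u m = (4 : ℝ) ^ m • (u n - ((1 / 4 : ℝ) ^ m) • u m) := by
        rw [smul_sub, smul_smul, ← mul_pow]; norm_num
      rw [h3, posPart_smul (by positivity)]
      calc (u n - ((1 / 4 : ℝ) ^ m) • u m)⁺ = (1 : ℝ) • _ := (one_smul _ _).symm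
        _ ≤ _ := smul_le_smul_of_nonneg_right (one_le_pow₀ (by norm_num)) (posPart_nonneg _)
    · refine le_trans ?_ (le_add_of_nonneg_right (hq2 m))
      exact smul_le_smul_of_nonneg_left (Finset.single_le_sum (f := u) (fun k _ => hu0 k)
        (Finset.mem_range.2 hnm)) (by positivity)
  refine ⟨fun n => (u n - q n)⁺, fun n => posPart_nonneg _,
    fun n => sup_le (sub_le_self _ (hq0 n)) (hu0 n), fun m n hmn => ?_, ?_⟩
  · rcases lt_or_gt_of_ne hmn with h | h
    · exact hlt m n h
    · change (u m - q m)⁺ ⊓ (u n - q n)⁺ = 0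
      rw [inf_comm]; exact hlt n m h
  have hlim : Tendsto (fun m : ℕ => (1 / 2 : ℝ) ^ m * (1 + ‖w‖)) atTop (𝓝 0) := by
    simpa using (tendsto_pow_atTop_nhds_zero_of_lt_one (r := (1 / 2 : ℝ)) (by norm_num)
      (by norm_num)).mul_const (1 + ‖w‖)
  refine squeeze_zero_norm (fun m => ?_) hlim
  rw [sub_posPart_sub]
  have h1 : u m ⊓ q m ≤ (4 : ℝ) ^ m • ∑ n ∈ Finset.range m, u m ⊓ u n + (1 / 2 : ℝ) ^ m • w := by
    refine (inf_add_le_inf_add_inf (hu0 m) (hq1 m) (hq2 m)).trans (add_le_add ?_ inf_le_right)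
    refine (inf_smul_le (hu0 m) (one_le_pow₀ (by norm_num))).trans ?_
    exact smul_le_smul_of_nonneg_left (inf_sum_le (hu0 m) hu0 m) (by positivity)
  refine (norm_le_norm_of_nonneg (le_inf (hu0 m) (hq0 m)) h1).trans ((norm_add_le _ _).trans ?_)
  rw [norm_smul, norm_smul, mul_add, mul_one]
  have h2 : ‖∑ n ∈ Finset.range m, u m ⊓ u n‖ ≤ (1 / 8 : ℝ) ^ m := by
    refine (norm_sum_le_of_le _ (f := fun n => u m ⊓ u n)
      (n := fun _ => (1 / 8 : ℝ) ^ m / ((m : ℝ) + 1)) fun n hn => ?_).trans ?_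
    · rw [inf_comm]; exact hsmall n m (Finset.mem_range.1 hn)
    · rw [Finset.sum_const, Finset.card_range, nsmul_eq_mul, mul_div_left_comm]
      refine mul_le_of_le_one_right (by positivity) ?_
      rw [div_le_one (by positivity)]
      linarith
  have h3 : ‖(4 : ℝ) ^ m‖ * ‖∑ n ∈ Finset.range m, u m ⊓ u n‖ ≤ (1 / 2 : ℝ) ^ m := by
    calc _ ≤ (4 : ℝ) ^ m * (1 / 8) ^ m := by
          rw [Real.norm_of_nonneg (by positivity)]
          gcongr
      _ = (1 / 2 : ℝ) ^ m := by rw [← mul_pow]; norm_num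
  have h4 : ‖(1 / 2 : ℝ) ^ m‖ = (1 / 2 : ℝ) ^ m := Real.norm_of_nonneg (by positivity)
  rw [h4]
  exact add_le_add_left h3 _

/-- If the norms stayed above `ε` frequently, a subsequence could be chosen with each term almost
disjoint from all earlier ones. It would be a null perturbation of a disjoint sequence lying below
it, which is null by `hdis`. -/
theorem tendsto_zero_of_disjoint {e : ℕ → E} (he0 : ∀ n, 0 ≤ e n) {C : ℝ} (hC : ∀ n, ‖e n‖ ≤ C)
    (hpair : ∀ n, Tendsto (fun m => e n ⊓ e m) atTop (𝓝 0))
    (hdis : ∀ z : ℕ → E, (∀ m, 0 ≤ z m) → (∀ m, ∃ k, z m ≤ e k) →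
      (Pairwise fun m n => z m ⊓ z n = 0) → Tendsto z atTop (𝓝 0)) :
    Tendsto e atTop (𝓝 0) := by
  by_contra hcon
  rw [NormedAddGroup.tendsto_nhds_zero] at hcon
  push Not at hcon
  obtain ⟨ε, hε, hfreq⟩ := hcon
  have hsel : ∀ m N : ℕ, ∃ k, N < k ∧ ε ≤ ‖e k‖ ∧
      ∀ i ≤ N, ‖e i ⊓ e k‖ ≤ (1 / 8) ^ m / ((m : ℝ) + 1) := by
    intro m N
    have hpos : (0 : ℝ) < (1 / 8) ^ m / ((m : ℝ) + 1) := by positivity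
    have h1 : ∀ᶠ k in atTop, ∀ i ≤ N, ‖e i ⊓ e k‖ ≤ (1 / 8) ^ m / ((m : ℝ) + 1) := by
      refine (Filter.eventually_all_finite (Set.finite_Iic N)).2 fun i _ => ?_
      filter_upwards [NormedAddGroup.tendsto_nhds_zero.1 (hpair i) _ hpos] with k hk
        using hk.le
    obtain ⟨k, h2, h3, h4⟩ := (hfreq.and_eventually (h1.and (eventually_gt_atTop N))).exists
    exact ⟨k, h4, h2, h3⟩
  choose s hs1 hs2 hs3 using hsel
  let σ : ℕ → ℕ := fun n => Nat.rec (s 0 0) (fun m N => s (m + 1) N) n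
  have hσ : ∀ m, σ (m + 1) = s (m + 1) (σ m) := fun m => rfl
  have hmono : StrictMono σ := strictMono_nat_of_lt_succ fun m => by rw [hσ]; exact hs1 _ _
  have hσε : ∀ m, ε ≤ ‖e (σ m)‖ := by
    rintro (_ | m)
    · exact hs2 0 0
    · exact hs2 _ _
  obtain ⟨z, hz0, hzu, hzd, hz⟩ := exists_disjoint_of_inf_small (u := fun m => e (σ m))
    (fun m => he0 _) (fun m => hC _) (by
      rintro n (_ | m) hnm
      · omega
      · exact hs3 (m + 1) (σ m) (σ n) (hmono.monotone (by omega)))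
  have h1 := (hz.add (hdis z hz0 (fun m => ⟨_, hzu m⟩) hzd)).norm
  simp only [sub_add_cancel, add_zero, norm_zero] at h1
  exact absurd (ge_of_tendsto' h1 hσε) (not_le.2 hε)

end Disjoint

/-! ### Criteria for KB-spaces -/

section KBSpace

variable {E : Type u} [NormedAddCommGroup E] [NormedSpace ℝ E] [Lattice E]
  [IsOrderedAddMonoid E] [IsOrderedModule ℝ E] [HasSolidNorm E] [CompleteSpace E]

/-- If disjoint sequences of `[0, u]` are norm null, then the parts above the level `c u` of an
order bounded series are norm null: at most `1 / c` of them overlap. -/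
theorem tendsto_posPart_inf_sub_of_disjoint {u : E} (hu : 0 ≤ u)
    (hdis : ∀ z : ℕ → E, (∀ m, 0 ≤ z m) → (∀ m, z m ≤ u) →
      (Pairwise fun m n => z m ⊓ z n = 0) → Tendsto z atTop (𝓝 0)) {c : ℝ} (hc : 0 < c) (k : ℕ) :
    ∀ (j : ℕ) (d : ℕ → E) (b : E), 1 ≤ ((j : ℝ) + k) * c → (∀ n, 0 ≤ d n) → 0 ≤ b →
      (∀ N, (j : ℝ) • b + ∑ n ∈ Finset.range N, d n ≤ u) →
      Tendsto (fun n => (d n ⊓ b - c • u)⁺) atTop (𝓝 0) := by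
  induction k with
  | zero =>
    intro j d b hj hd hb hN
    have h1 : b ≤ c • u := by
      calc b = (1 : ℝ) • b := (one_smul _ _).symm
        _ ≤ (c * j) • b := smul_le_smul_of_nonneg_right (by simpa [mul_comm] using hj) hb
        _ = c • ((j : ℝ) • b) := mul_smul _ _ _
        _ ≤ c • u := smul_le_smul_of_nonneg_left (by simpa using hN 0) hc.le
    refine tendsto_const_nhds.congr fun n => ?_
    exact (posPart_eq_zero.2 (sub_nonpos.2 (inf_le_right.trans h1))).symm
  | succ k ih =>
    intro j d b hj hd hb hN
    have hjb : 0 ≤ (j : ℝ) • b := smul_nonneg (Nat.cast_nonneg j) hb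
    have hdu : ∀ n, d n ≤ u := fun n => by
      refine le_trans ?_ (hN (n + 1))
      refine le_trans ?_ (le_add_of_nonneg_left hjb)
      exact Finset.single_le_sum (fun k _ => hd k) (Finset.self_mem_range_succ n)
    have he : ∀ n, (d n ⊓ b - c • u)⁺ ≤ u := fun n =>
      sup_le ((sub_le_self _ (smul_nonneg hc.le hu)).trans (inf_le_left.trans (hdu n))) hu
    refine tendsto_zero_of_disjoint (fun n => posPart_nonneg _) (C := ‖u‖)
      (fun n => norm_le_norm_of_nonneg (posPart_nonneg _) (he n)) (fun n => ?_)
      (fun z hz0 hz hzd => hdis z hz0 (fun m => ?_) hzd)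
    -- Intersecting with `d n` uses up one term of the series: `j • b + d n` majorises `(j + 1) • (b
    -- ⊓ d n)`. So `e n ⊓ e m` is the same expression at depth `j + 1`, and tends to `0` by
    -- induction.
    · have h1 := ih (j + 1) (fun m => d (m + (n + 1))) (b ⊓ d n)
        (by push_cast at hj ⊢; linarith) (fun m => hd _) (le_inf hb (hd n)) (fun N => by
          refine le_trans ?_ (hN (N + (n + 1)))
          have h2 : d n + ∑ m ∈ Finset.range N, d (m + (n + 1)) ≤
              ∑ m ∈ Finset.range (N + (n + 1)), d m := by
            rw [add_comm N, Finset.sum_range_add]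
            refine add_le_add ?_ (Finset.sum_le_sum fun m _ => by rw [add_comm])
            exact Finset.single_le_sum (fun k _ => hd k) (Finset.self_mem_range_succ n)
          refine le_trans ?_ (add_le_add_right h2 _)
          rw [← add_assoc]
          refine add_le_add_left ?_ _
          push_cast
          rw [add_smul, one_smul]
          exact add_le_add (smul_le_smul_of_nonneg_left inf_le_left (Nat.cast_nonneg j))
            inf_le_right)
      refine (tendsto_add_atTop_iff_nat (n + 1)).1 (h1.congr fun m => ?_)
      rw [posPart_inf_posPart, ← inf_sub]
      congr 2
      rw [inf_comm b, ← inf_assoc, inf_comm _ (d n), inf_inf_distrib_right, inf_assoc]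
    · obtain ⟨k, hk⟩ := hz m
      exact hk.trans (he k)

/-- Increments have all partial sums below `u`, so their parts above `c • u` are norm null; the
remainder has norm at most `c * ‖u‖`. -/
theorem monotoneConvergesBelow_of_disjoint {u : E} (hu : 0 ≤ u)
    (hdis : ∀ z : ℕ → E, (∀ m, 0 ≤ z m) → (∀ m, z m ≤ u) →
      (Pairwise fun m n => z m ⊓ z n = 0) → Tendsto z atTop (𝓝 0)) :
    MonotoneConvergesBelow u := by
  intro x hx h0 hxu
  refine cauchySeq_tendsto_of_complete (cauchySeq_of_subseq_diff fun σ hσ => ?_)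
  set d : ℕ → E := fun k => x (σ (k + 1)) - x (σ k) with hd
  have hd0 : ∀ k, 0 ≤ d k := fun k => sub_nonneg.2 (hx (hσ.monotone k.le_succ))
  have hsum : ∀ N, ∑ k ∈ Finset.range N, d k ≤ u := fun N => by
    rw [hd, Finset.sum_range_sub (fun k => x (σ k))]
    exact (sub_le_self _ (h0 _)).trans (hxu _)
  have hdu : ∀ k, d k ≤ u := fun k => (sub_le_self _ (h0 _)).trans (hxu _)
  rw [NormedAddGroup.tendsto_nhds_zero]
  intro ε hε
  obtain ⟨c, hc, hcu⟩ : ∃ c : ℝ, 0 < c ∧ c * ‖u‖ < ε / 2 := by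
    refine ⟨ε / 2 / (‖u‖ + 1), by positivity, ?_⟩
    rw [div_mul_eq_mul_div, div_lt_iff₀ (by positivity)]
    nlinarith [norm_nonneg u]
  obtain ⟨k, hk⟩ := exists_nat_gt (1 / c)
  rw [div_lt_iff₀ hc] at hk
  have h1 := tendsto_posPart_inf_sub_of_disjoint hu hdis hc k 0 d u (by simpa using hk.le) hd0 hu
    (fun N => by simpa using hsum N)
  filter_upwards [NormedAddGroup.tendsto_nhds_zero.1 h1 (ε / 2) (by positivity)] with n hn
  rw [inf_eq_left.2 (hdu n)] at hn
  have h2 : d n ≤ (d n - c • u)⁺ + c • u := sub_le_iff_le_add.1 (le_posPart _)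
  have h3 := (norm_le_norm_of_nonneg (hd0 n) h2).trans (norm_add_le _ _)
  rw [norm_smul, Real.norm_of_nonneg hc.le] at h3
  linarith

/-- The hypothesis serves twice: on `[0, d n]` it yields a functional controlling the norm of `d n ⊓
d m`, and then it applies to the disjoint sequences below the increments. -/
theorem isKBSpace_of_disjoint
    (hdis : ∀ φ : StrongDual ℝ (StrongDual ℝ E), BidualNonneg φ → ∀ z : ℕ → E, (∀ m, 0 ≤ z m) →
      (∀ m, DominatedBy φ 0 (z m)) → (Pairwise fun m n => z m ⊓ z n = 0) →
      Tendsto z atTop (𝓝 0)) : IsKBSpace E := by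
  rintro x hx h0 ⟨C, hC⟩
  obtain ⟨φ, hφ, hxφ⟩ := exists_bidual_dominating hx h0 hC
  refine cauchySeq_tendsto_of_complete (cauchySeq_of_subseq_diff fun σ hσ => ?_)
  set d : ℕ → E := fun k => x (σ (k + 1)) - x (σ k) with hd
  have hd0 : ∀ k, 0 ≤ d k := fun k => sub_nonneg.2 (hx (hσ.monotone k.le_succ))
  have hdx : ∀ k, d k ≤ x (σ (k + 1)) := fun k => sub_le_self _ (h0 _)
  have hdφ : ∀ k, DominatedBy φ 0 (d k) := fun k => (hxφ _).of_le (hdx k)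
  refine tendsto_zero_of_disjoint hd0
    (fun k => (norm_le_norm_of_nonneg (hd0 k) (hdx k)).trans (hC _)) (fun n => ?_)
    (fun z hz0 hz hzd => hdis φ hφ z hz0 (fun m => ?_) hzd)
  · have hoc : MonotoneConvergesBelow (d n) := monotoneConvergesBelow_of_disjoint (hd0 n)
      fun z hz0 hz hzd => hdis φ hφ z hz0 (fun m => (hdφ n).of_le (hz m)) hzd
    rw [NormedAddGroup.tendsto_nhds_zero]
    intro ε hε
    obtain ⟨g, hg, hgn⟩ := hoc.exists_norm_le (half_pos hε)
    -- The values of `g` increase and are bounded by `φ g`, so `g` tends to `0` on the increments.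
    have hgx : Tendsto (fun k => g (x (σ k))) atTop (𝓝 (⨆ k, g (x (σ k)))) :=
      tendsto_atTop_ciSup (fun i j hij => hg.mono (hx (hσ.monotone hij)))
        ⟨φ g, by rintro _ ⟨k, rfl⟩; simpa using hxφ (σ k) g hg⟩
    have hgd : Tendsto (fun k => g (d k)) atTop (𝓝 0) := by
      have := (hgx.comp (tendsto_add_atTop_nat 1)).sub hgx
      rw [sub_self] at this
      exact this.congr fun k => (map_sub g _ _).symm
    filter_upwards [hgd.eventually (gt_mem_nhds (half_pos hε))] with m hm
    have h1 := hgn (d n ⊓ d m) (le_inf (hd0 n) (hd0 m)) inf_le_left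
    have h2 := hg.mono (inf_le_right : d n ⊓ d m ≤ d m)
    linarith
  · obtain ⟨k, hk⟩ := hz m
    exact (hdφ k).of_le hk

/-- Changing signs of positive terms does not increase the norm of the sum, so matching the signs of
`f (a n)` shows that `f (a n)` is absolutely summable. The modulus of `f` is not needed. -/
theorem tendsto_apply_zero_of_sum_bounded {a : ℕ → E} (ha : ∀ n, 0 ≤ a n) {C : ℝ}
    (hC : ∀ N, ‖∑ n ∈ Finset.range N, a n‖ ≤ C) (f : StrongDual ℝ E) :
    Tendsto (fun n => f (a n)) atTop (𝓝 0) := by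
  have h : ∀ N, ∑ n ∈ Finset.range N, |f (a n)| ≤ ‖f‖ * C := by
    intro N
    let s : ℕ → ℝ := fun n => if 0 ≤ f (a n) then 1 else -1
    have hs : ∀ n, |f (a n)| = s n * f (a n) := by
      intro n
      simp only [s]
      split_ifs with h
      · rw [abs_of_nonneg h, one_mul]
      · rw [abs_of_neg (not_le.1 h), neg_one_mul]
    have hsa : ∀ n, s n • a n ≤ a n ∧ -(s n • a n) ≤ a n := by
      intro n
      have h2 : -a n ≤ a n := (neg_nonpos.2 (ha n)).trans (ha n)
      simp only [s]
      split_ifs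
      · rw [one_smul]; exact ⟨le_rfl, h2⟩
      · rw [neg_smul, one_smul, neg_neg]; exact ⟨h2, le_rfl⟩
    have h1 : ‖∑ n ∈ Finset.range N, s n • a n‖ ≤ ‖∑ n ∈ Finset.range N, a n‖ := by
      refine norm_le_norm_of_abs_le_abs ?_
      rw [abs_of_nonneg (Finset.sum_nonneg fun n _ => ha n), abs_le', ← Finset.sum_neg_distrib]
      exact ⟨Finset.sum_le_sum fun n _ => (hsa n).1, Finset.sum_le_sum fun n _ => (hsa n).2⟩
    calc ∑ n ∈ Finset.range N, |f (a n)| = f (∑ n ∈ Finset.range N, s n • a n) := by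
          rw [map_sum]
          exact Finset.sum_congr rfl fun n _ => by rw [map_smul, smul_eq_mul, hs]
      _ ≤ ‖f‖ * ‖∑ n ∈ Finset.range N, s n • a n‖ := (le_abs_self _).trans (f.le_opNorm _)
      _ ≤ ‖f‖ * C := mul_le_mul_of_nonneg_left (h1.trans (hC N)) (norm_nonneg f)
  have h2 := (summable_of_sum_range_le (fun n => abs_nonneg (f (a n))) h).tendsto_atTop_zero
  exact (tendsto_zero_iff_abs_tendsto_zero _).2 h2

theorem isKBSpace_of_uaw_null
    (h : ∀ φ : StrongDual ℝ (StrongDual ℝ E), BidualNonneg φ → ∀ x : ℕ → E,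
      (∀ n, x n ∈ bInterval φ) → UawTendsto x atTop 0 → Tendsto x atTop (𝓝 0)) :
    IsKBSpace E := by
  rintro x hx h0 ⟨C, hC⟩
  obtain ⟨φ, hφ, hxφ⟩ := exists_bidual_dominating hx h0 hC
  refine cauchySeq_tendsto_of_complete (cauchySeq_of_subseq_diff fun σ hσ => ?_)
  set d : ℕ → E := fun k => x (σ (k + 1)) - x (σ k) with hd
  have hd0 : ∀ k, 0 ≤ d k := fun k => sub_nonneg.2 (hx (hσ.monotone k.le_succ))
  have hdx : ∀ k, d k ≤ x (σ (k + 1)) := fun k => sub_le_self _ (h0 _)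
  refine h φ hφ d (fun k => mem_bInterval_iff.2 ?_) fun y hy f => ?_
  · rw [abs_of_nonneg (hd0 k)]
    exact (hxφ _).of_le (hdx k)
  · have hdy : ∀ k, 0 ≤ |d k - 0| ⊓ y := fun k => le_inf (abs_nonneg _) hy
    refine tendsto_apply_zero_of_sum_bounded hdy (C := C) (fun N => ?_) f
    refine le_trans ?_ (hC (σ N))
    refine norm_le_norm_of_nonneg (Finset.sum_nonneg fun k _ => hdy k) ?_
    calc ∑ k ∈ Finset.range N, |d k - 0| ⊓ y ≤ ∑ k ∈ Finset.range N, d k := by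
          refine Finset.sum_le_sum fun k _ => ?_
          rw [sub_zero, abs_of_nonneg (hd0 k)]; exact inf_le_left
      _ = x (σ N) - x (σ 0) := Finset.sum_range_sub (fun k => x (σ k)) N
      _ ≤ x (σ N) := sub_le_self _ (h0 _)

end KBSpace

/-! ### From uaw convergence and compactness to the norm -/

section Uaw

variable {E : Type u} [NormedAddCommGroup E] [NormedSpace ℝ E] [Lattice E]
  [IsOrderedAddMonoid E] [IsOrderedModule ℝ E] [HasSolidNorm E]

theorem isBSemiCompact_bInterval {φ : StrongDual ℝ (StrongDual ℝ E)} (hφ : BidualNonneg φ) :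
    IsBSemiCompact (bInterval φ : Set E) :=
  fun ε hε => ⟨φ, hφ, fun x hx => ⟨_, hx, by
    rw [sub_self]
    exact (norm_zero (E := StrongDual ℝ (StrongDual ℝ E))).trans_le hε.le⟩⟩

theorem IsKBSpace.exists_norm_le_inf (h : IsKBSpace E) {ε : ℝ} (hε : 0 < ε)
    {φ : StrongDual ℝ (StrongDual ℝ E)} (hφ : BidualNonneg φ) :
    ∃ (g : StrongDual ℝ E) (y : E), DualNonneg g ∧ 0 ≤ y ∧
      ∀ x ∈ bInterval φ, ‖x‖ ≤ g (|x| ⊓ y) + ε := by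
  obtain ⟨w, hw0, hw⟩ := h.exists_upper_bound hφ
  obtain ⟨g, hg, hgw⟩ := (h.monotoneConvergesBelow w).exists_norm_le hε
  refine ⟨g, w, hg, hw0, fun x hx => ?_⟩
  have h1 := hw _ (mem_bInterval_iff.1 hx)
  rw [inf_eq_left.2 h1, ← norm_abs_eq_norm]
  exact hgw _ (abs_nonneg x) h1

theorem UawTendsto.tendsto_zero_of_norm_le_inf {φ : StrongDual ℝ (StrongDual ℝ E)}
    (h : ∀ ε : ℝ, 0 < ε → ∃ (g : StrongDual ℝ E) (y : E), DualNonneg g ∧ 0 ≤ y ∧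
      ∀ x ∈ bInterval φ, ‖x‖ ≤ g (|x| ⊓ y) + ε)
    {ι : Type w} {l : Filter ι} {x : ι → E} (hx : ∀ i, x i ∈ bInterval φ)
    (hl : UawTendsto x l 0) : Tendsto x l (𝓝 0) := by
  rw [NormedAddGroup.tendsto_nhds_zero]
  intro ε hε
  obtain ⟨g, y, -, hy, h1⟩ := h (ε / 2) (half_pos hε)
  filter_upwards [(hl y hy g).eventually (gt_mem_nhds (half_pos hε))] with i hi
  rw [sub_zero] at hi
  linarith [h1 _ (hx i)]

/-- In a KB-space, uaw convergence of a b-order bounded net is norm convergence. -/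
theorem IsKBSpace.tendsto_of_uawTendsto (h : IsKBSpace E) {φ : StrongDual ℝ (StrongDual ℝ E)}
    (hφ : BidualNonneg φ) {ι : Type w} {l : Filter ι} {x : ι → E}
    (hx : ∀ i, x i ∈ bInterval φ) {a : E} (hl : UawTendsto x l a) : Tendsto x l (𝓝 a) := by
  -- Translating by `a` keeps the net b-order bounded, with `φ` enlarged by `|a|`.
  have hψ : BidualNonneg (φ + NormedSpace.inclusionInDoubleDual ℝ E |a|) := by
    intro f hf
    rw [_root_.add_apply]
    exact add_nonneg (hφ f hf) (bidualNonneg_inclusion (abs_nonneg a) f hf)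
  have h1 : Tendsto (fun i => x i - a) l (𝓝 0) := by
    refine UawTendsto.tendsto_zero_of_norm_le_inf (fun ε hε => h.exists_norm_le_inf hε hψ)
      (fun i => mem_bInterval_iff.2 fun f hf => ?_) (fun y hy f => by simpa using hl y hy f)
    have h4 : |x i - a| ≤ |x i| + |a| := by
      rw [abs_le', neg_sub, sub_eq_add_neg, sub_eq_neg_add]
      exact ⟨add_le_add (le_abs_self _) (neg_le_abs _),
        add_le_add (neg_le_abs _) (le_abs_self _)⟩
    have h2 := hf.mono h4
    have h3 := mem_bInterval_iff.1 (hx i) f hf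
    rw [map_add] at h2
    rw [_root_.add_apply, NormedSpace.dual_def]
    linarith
  simpa using h1.add_const a

/-- The uaw-convergent subnet converges in norm, so `a` is a norm cluster point of the sequence, and
metrizability turns the subnet into a subsequence. -/
theorem exists_subseq_of_hasUawSubnet (h : IsKBSpace E) {A : Set E} (hA : IsBOrderBounded A)
    {x : ℕ → E} (hx : ∀ n, x n ∈ A) {a : E}
    (ha : HasUawSubnetTendsto (fun i : ULift.{u} ℕ => x i.down) a) :
    ∃ σ : ℕ → ℕ, StrictMono σ ∧ Tendsto (x ∘ σ) atTop (𝓝 a) := by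
  obtain ⟨φ, hφ, hAφ⟩ := hA
  obtain ⟨κ, _, _, _, ψ, hψ, hl⟩ := ha
  have h1 := h.tendsto_of_uawTendsto hφ (fun k => hAφ (hx (ψ k).down)) hl
  have h2 : Tendsto (fun k => (ψ k).down) atTop atTop :=
    tendsto_atTop.2 fun n => (tendsto_atTop.1 hψ ⟨n⟩).mono fun _ hk => hk
  have h3 : MapClusterPt a atTop x := MapClusterPt.of_comp h2 h1.mapClusterPt
  exact MapClusterPt.tendsto_subseq h3

theorem IsKBSpace.isCompact_of_isUawCompact (h : IsKBSpace E) {A : Set E}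
    (hA : IsBOrderBounded A) (hu : IsUawCompact A) : IsCompact A := by
  refine IsSeqCompact.isCompact fun x hx => ?_
  obtain ⟨a, ha, hxa⟩ := hu.2 (ULift.{u} ℕ) (fun i => x i.down) fun i => hx _
  exact ⟨a, ha, exists_subseq_of_hasUawSubnet h hA hx hxa⟩

theorem IsKBSpace.isCompact_closure_of_isRelUawCompact (h : IsKBSpace E) {A : Set E}
    (hA : IsBOrderBounded A) (hu : IsRelUawCompact A) : IsCompact (closure A) := by
  refine IsSeqCompact.isCompact fun x hx => ?_
  choose y hyA hy using fun n : ℕ => Metric.mem_closure_iff.1 (hx n) (1 / ((n : ℝ) + 1))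
    Nat.one_div_pos_of_nat
  obtain ⟨a, hya⟩ := hu.2 (ULift.{u} ℕ) (fun i => y i.down) fun i => hyA _
  obtain ⟨σ, hσ, hlim⟩ := exists_subseq_of_hasUawSubnet h hA hyA hya
  have h1 : Tendsto (fun n => dist (x (σ n)) (y (σ n))) atTop (𝓝 0) :=
    squeeze_zero (fun n => dist_nonneg) (fun n => (hy (σ n)).le)
      (tendsto_one_div_add_atTop_nhds_zero_nat.comp hσ.tendsto_atTop)
  have h2 : Tendsto (x ∘ σ) atTop (𝓝 a) := by
    refine hlim.congr_dist ?_
    simpa only [Function.comp_apply, dist_comm] using h1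
  exact ⟨a, mem_closure_of_tendsto hlim (Eventually.of_forall fun n => hyA _), σ, hσ, h2⟩

theorem UawTendsto.comp {ι κ : Type*} {x : ι → E} {l : Filter ι} {a : E}
    (h : UawTendsto x l a) {σ : κ → ι} {l' : Filter κ} (hσ : Tendsto σ l' l) :
    UawTendsto (x ∘ σ) l' a :=
  fun y hy f => (h y hy f).comp hσ

/-- The range of a uaw-null sequence together with `0` is uaw-compact. -/
theorem isUawCompact_insert_zero_range {x : ℕ → E} (hb : Bornology.IsBounded (Set.range x))
    (hx : UawTendsto x atTop 0) : IsUawCompact (insert 0 (Set.range x)) := by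
  refine ⟨hb.insert 0, ?_⟩
  intro ι _ _ _ y hy
  -- A value taken cofinally gives a constant subnet. Otherwise the net eventually avoids `x 0, …, x
  -- (N - 1)` for every `N`, so it is itself uaw-null.
  by_cases hf : ∃ a ∈ insert 0 (Set.range x), ∃ᶠ i in atTop, y i = a
  · obtain ⟨a, ha, hf⟩ := hf
    have hcof : ∀ i, ∃ j, i ≤ j ∧ y j = a := fun i => (frequently_atTop.1 hf) i
    obtain ⟨i₀, -, hi₀⟩ := hcof (Classical.arbitrary ι)
    refine ⟨a, ha, {i // y i = a}, inferInstance, ⟨fun i j => ?_⟩, ⟨⟨i₀, hi₀⟩⟩, Subtype.val,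
      ?_, ?_⟩
    · obtain ⟨k, hik, hjk⟩ := exists_ge_ge i.1 j.1
      obtain ⟨m, hm, hma⟩ := hcof k
      exact ⟨⟨m, hma⟩, hik.trans hm, hjk.trans hm⟩
    · refine tendsto_atTop.2 fun i => ?_
      obtain ⟨j, hj, hja⟩ := hcof i
      have : Nonempty {i // y i = a} := ⟨⟨j, hja⟩⟩
      filter_upwards [Filter.mem_atTop (⟨j, hja⟩ : {i // y i = a})] with k hk
      exact hj.trans hk
    · intro z hz f
      refine tendsto_const_nhds.congr fun k => ?_
      have : (y ∘ Subtype.val) k = a := k.2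
      rw [this, sub_self, abs_zero, inf_eq_left.2 hz, map_zero]
  · push Not at hf
    refine ⟨0, Set.mem_insert _ _, ι, inferInstance, inferInstance, inferInstance, id, tendsto_id,
      fun z hz f => ?_⟩
    rw [NormedAddGroup.tendsto_nhds_zero]
    intro ε hε
    obtain ⟨N, hN⟩ := eventually_atTop.1 (NormedAddGroup.tendsto_nhds_zero.1 (hx z hz f) ε hε)
    have h1 : ∀ᶠ i in atTop, ∀ n < N, y i ≠ x n :=
      (Filter.eventually_all_finite (Set.finite_Iio N)).2 fun n _ =>
        hf (x n) (Set.mem_insert_of_mem _ ⟨n, rfl⟩)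
    filter_upwards [h1] with i hi
    rcases hy i with h0 | ⟨n, hn⟩
    · change ‖f (|y i - 0| ⊓ z)‖ < ε
      rw [h0, sub_self, abs_zero, inf_eq_left.2 hz, map_zero, norm_zero]
      exact hε
    · have h2 : N ≤ n := by
        by_contra! h3
        exact hi n h3 hn.symm
      have h3 := hN n h2
      rw [hn] at h3
      exact h3

theorem IsUawCompact.isRelUawCompact {A : Set E} (h : IsUawCompact A) : IsRelUawCompact A :=
  ⟨h.1, fun ι _ _ _ x hx => (h.2 ι x hx).imp fun _ ha => ha.2⟩

/-- At a norm cluster point `a`, testing against `y = |a|` and a positive functional norming `|a|`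
gives `‖a‖ = 0`. -/
theorem UawTendsto.tendsto_zero_of_isCompact {x : ℕ → E} (hx : UawTendsto x atTop 0) {K : Set E}
    (hK : IsCompact K) (hxK : ∀ n, x n ∈ K) : Tendsto x atTop (𝓝 0) := by
  refine hK.tendsto_nhds_of_unique_mapClusterPt (Eventually.of_forall hxK) fun a _ ha => ?_
  obtain ⟨σ, hσ, hlim⟩ := MapClusterPt.tendsto_subseq ha
  obtain ⟨f, -, -, hf⟩ := exists_dualNonneg_norming (abs_nonneg a)
  have h1 := (hx.comp hσ.tendsto_atTop) |a| (abs_nonneg a) f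
  have hc : Continuous fun z : E => f (|z - 0| ⊓ |a|) := by
    simp only [abs]
    fun_prop
  have h2 := (hc.tendsto a).comp hlim
  have h3 := tendsto_nhds_unique h1 h2
  simp only [sub_zero, inf_idem] at h3
  rw [hf, norm_abs_eq_norm] at h3
  exact norm_eq_zero.1 h3.symm

theorem tendsto_zero_of_forall_isUawCompact
    (h : ∀ A : Set E, IsBOrderBounded A → IsUawCompact A → ∃ K, IsCompact K ∧ A ⊆ K)
    {φ : StrongDual ℝ (StrongDual ℝ E)} (hφ : BidualNonneg φ) {x : ℕ → E}
    (hx : ∀ n, x n ∈ bInterval φ) (hl : UawTendsto x atTop 0) : Tendsto x atTop (𝓝 0) := by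
  have hr : Set.range x ⊆ bInterval φ := by rintro _ ⟨n, rfl⟩; exact hx n
  obtain ⟨K, hK, hAK⟩ := h _ ⟨φ, hφ, Set.insert_subset
    (mem_bInterval_iff.2 (by rw [abs_zero]; exact hφ.dominatedBy_zero)) hr⟩
    (isUawCompact_insert_zero_range (isBounded_bInterval.subset hr) hl)
  exact hl.tendsto_zero_of_isCompact hK fun n => hAK (Set.mem_insert_of_mem _ ⟨n, rfl⟩)

end Uaw

end BanachLattice

/-! ### The equivalences -/

open BanachLattice

theorem corollary3p15 {E : Type u} [NormedAddCommGroup E] [NormedSpace ℝ E] [CompleteSpace E]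
    [Lattice E] [IsOrderedAddMonoid E] [IsOrderedModule ℝ E] [HasSolidNorm E] :
    List.TFAE [
      BanachLattice.IsKBSpace E,
      ∀ S : Set E, BanachLattice.IsBSemiCompact S → BanachLattice.IsLWeaklyCompact S,
      ∀ φ : StrongDual ℝ (StrongDual ℝ E), BanachLattice.BidualNonneg φ →
        BanachLattice.IsLwcOn (BanachLattice.bInterval φ) (ContinuousLinearMap.id ℝ E),
      ∀ ε : ℝ, 0 < ε → ∀ φ : StrongDual ℝ (StrongDual ℝ E), BanachLattice.BidualNonneg φ →
        ∃ (g : StrongDual ℝ E) (y : E), BanachLattice.DualNonneg g ∧ 0 ≤ y ∧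
          ∀ x ∈ BanachLattice.bInterval φ, ‖x‖ ≤ g (|x| ⊓ y) + ε,
      ∀ φ : StrongDual ℝ (StrongDual ℝ E), BanachLattice.BidualNonneg φ →
        ∀ (ι : Type w) [Preorder ι] [IsDirectedOrder ι] [Nonempty ι] (x : ι → E),
          (∀ i, x i ∈ BanachLattice.bInterval φ) → BanachLattice.UawTendsto x atTop 0 →
            Tendsto x atTop (𝓝 0),
      ∀ φ : StrongDual ℝ (StrongDual ℝ E), BanachLattice.BidualNonneg φ →
        ∀ x : ℕ → E, (∀ n, x n ∈ BanachLattice.bInterval φ) →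
          BanachLattice.UawTendsto x atTop 0 → Tendsto x atTop (𝓝 0),
      ∀ A : Set E, BanachLattice.IsBOrderBounded A → BanachLattice.IsUawCompact A → IsCompact A,
      ∀ A : Set E, BanachLattice.IsBOrderBounded A → BanachLattice.IsRelUawCompact A →
        IsCompact (closure A)] := by
  tfae_have 1 → 2 := fun h S hS => h.isLWeaklyCompact hS
  tfae_have 2 → 1 := fun h => isKBSpace_of_disjoint fun φ hφ z hz0 hz hzd =>
    (h _ (isBSemiCompact_bInterval hφ)).2 z (fun n => subset_solidClosure_self _
      (mem_bInterval_iff.2 (by rw [abs_of_nonneg (hz0 n)]; exact hz n)))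
      (fun m n hmn => by simpa only [abs_of_nonneg (hz0 m), abs_of_nonneg (hz0 n)] using hzd hmn)
  tfae_have 1 → 4 := fun h ε hε φ hφ => h.exists_norm_le_inf hε hφ
  tfae_have 4 → 5 := fun h φ hφ ι _ _ _ x hx hl =>
    hl.tendsto_zero_of_norm_le_inf (fun ε hε => h ε hε φ hφ) hx
  tfae_have 5 → 6 := fun h φ hφ x hx hl => by
    -- Nets in 5 are indexed in `Type w`, so a sequence is reindexed through `ULift`.
    have hdown : Tendsto (ULift.down : ULift.{w} ℕ → ℕ) atTop atTop :=
      tendsto_atTop.2 fun n => Filter.mem_atTop (ULift.up n)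
    have hup : Tendsto (ULift.up : ℕ → ULift.{w} ℕ) atTop atTop :=
      tendsto_atTop.2 fun n => Filter.mem_atTop n.down
    exact (h φ hφ (ULift.{w} ℕ) (x ∘ ULift.down) (fun i => hx _) (hl.comp hdown)).comp hup
  tfae_have 6 → 1 := isKBSpace_of_uaw_null
  tfae_have 6 → 3 := fun h φ hφ => ⟨isBounded_bInterval, fun x hx hl =>
    h φ hφ x (fun n => mem_bInterval_of_mem_solidClosure (hx n)) hl⟩
  tfae_have 3 → 6 := fun h φ hφ x hx hl =>
    (h φ hφ).2 x (fun n => subset_solidClosure_self _ (hx n)) hl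
  tfae_have 1 → 7 := fun h A hA hu => h.isCompact_of_isUawCompact hA hu
  tfae_have 1 → 8 := fun h A hA hu => h.isCompact_closure_of_isRelUawCompact hA hu
  tfae_have 7 → 6 := fun h φ hφ x hx hl =>
    tendsto_zero_of_forall_isUawCompact (fun A hA hu => ⟨A, h A hA hu, subset_rfl⟩) hφ hx hl
  tfae_have 8 → 6 := fun h φ hφ x hx hl =>
    tendsto_zero_of_forall_isUawCompact
      (fun A hA hu => ⟨_, h A hA hu.isRelUawCompact, subset_closure⟩) hφ hx hl
  tfae_finish
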